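/- All graphs are finite and may have parallel edges and loops. A signed graph $(G,\sigma)$ is a graph $G$ with a map $\sigma:E(G)\to\{+1,-1\}$; an edge $e$ is negative if $\sigma(e)=-1$. A circuit is a connected $2$-regular graph; it is balanced if it has an even number of negative edges and unbalanced otherwise. A barbell consists of two unbalanced circuits $C_1,C_2$ and a path $P$ such that either $C_1,C_2$ share exactly one vertex and $P$ is the trivial path at that vertex, or $C_1,C_2$ are vertex-disjoint and $P$ is a nontrivial path from a vertex of $C_1$ to a vertex of $C_2$ that meets $C_1\cup C_2$ only in its two ends. A sign-circuit of $(G,\sigma)$ is a subgraph of $G$ that is a balanced circuit or a barbell. A $2$-factor is a spanning $2$-regular subgraph. **Lemma.** Let $F$ be a $2$-factor of a $2$-edge-connected cubic signed graph $(G,\sigma)$. If $F$ contains an even number of negative edges, then there is a finite family $\mathcal F$ of sign-circuits of $(G,\sigma)$ such that every edge of $F$ lies in some member of $\mathcal F$ and $$\ell(\mathcal F)=\sum_{S\in\mathcal F}|E(S)|\le \frac{10}{9}\,|E(G)|.$$ -/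

import Mathlib

namespace Graph

open scoped Graph

/-- The degree of a vertex of a multigraph: every edge joining it to another vertex counts once
and every loop counts twice. -/
noncomputable def degree {α β : Type*} (G : Graph α β) (x : α) : ℕ∞ :=
  {e | G.IsNonloopAt e x}.encard + 2 * {e | G.IsLoopAt e x}.encard

/-- Every vertex of `G` has degree `d`. -/
def IsRegular {α β : Type*} (G : Graph α β) (d : ℕ) : Prop :=
  ∀ x ∈ V(G), G.degree x = d

/-- A cubic graph is a `3`-regular graph. -/
def IsCubic {α β : Type*} (G : Graph α β) : Prop :=
  G.IsRegular 3

/-- `G` is nonempty and any two of its vertices are joined by a walk. -/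
def IsConnected {α β : Type*} (G : Graph α β) : Prop :=
  V(G).Nonempty ∧ ∀ x ∈ V(G), ∀ y ∈ V(G), Relation.ReflTransGen G.Adj x y

/-- `G` is connected and stays connected when any one edge is deleted. -/
def IsTwoEdgeConnected {α β : Type*} (G : Graph α β) : Prop :=
  G.IsConnected ∧ ∀ e ∈ E(G), (G.deleteEdges {e}).IsConnected

/-- A circuit is a connected `2`-regular graph (a single loop and a pair of parallel edges are
circuits). -/
def IsCircuit {α β : Type*} (C : Graph α β) : Prop :=
  C.IsConnected ∧ C.IsRegular 2

/-- A `2`-factor of `G` is a spanning `2`-regular subgraph of `G`. -/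
def IsTwoFactor {α β : Type*} (F G : Graph α β) : Prop :=
  F ≤s G ∧ F.IsRegular 2

/-- `P` is a path with ends `u` and `v`. It is trivial (the single vertex `u = v`) when `n = 0`. -/
def IsPathBetween {α β : Type*} (P : Graph α β) (u v : α) : Prop :=
  ∃ (n : ℕ) (x : Fin (n + 1) → α) (e : Fin n → β),
    Function.Injective x ∧ x 0 = u ∧ x (Fin.last n) = v ∧
      (∀ i : Fin n, P.IsLink (e i) (x i.castSucc) (x i.succ)) ∧
      V(P) = Set.range x ∧ E(P) = Set.range e

/-- The negative edges of the graph `G` under the signature `σ`; only the signs of the edges of `G`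
matter. -/
def negativeEdges {α β : Type*} (σ : β → ℤˣ) (G : Graph α β) : Set β :=
  {e ∈ E(G) | σ e = -1}

/-- A circuit with an even number of negative edges. -/
def IsBalancedCircuit {α β : Type*} (σ : β → ℤˣ) (C : Graph α β) : Prop :=
  C.IsCircuit ∧ Even (negativeEdges σ C).ncard

/-- A circuit with an odd number of negative edges. -/
def IsUnbalancedCircuit {α β : Type*} (σ : β → ℤˣ) (C : Graph α β) : Prop :=
  C.IsCircuit ∧ Odd (negativeEdges σ C).ncard

/-- `B` is the union of two unbalanced circuits `C₁`, `C₂` and a possibly trivial path `P` from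
`u` to `v`, where `P` meets `C₁` exactly in `u` and `C₂` exactly in `v`. If `P` is trivial then
the circuits share exactly the vertex `u = v` (a short barbell); otherwise they are disjoint
(a long barbell). -/
def IsBarbell {α β : Type*} (σ : β → ℤˣ) (B : Graph α β) : Prop :=
  ∃ (C₁ C₂ P : Graph α β) (u v : α),
    IsUnbalancedCircuit σ C₁ ∧ IsUnbalancedCircuit σ C₂ ∧ P.IsPathBetween u v ∧
      C₁ ≤ B ∧ C₂ ≤ B ∧ P ≤ B ∧
      V(B) = V(C₁) ∪ V(C₂) ∪ V(P) ∧ E(B) = E(C₁) ∪ E(C₂) ∪ E(P) ∧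
      V(C₁) ∩ V(P) = {u} ∧ V(C₂) ∩ V(P) = {v} ∧
      ((u = v ∧ V(C₁) ∩ V(C₂) = {u}) ∨ (u ≠ v ∧ V(C₁) ∩ V(C₂) = ∅))

/-- A sign-circuit is a balanced circuit or a barbell. -/
def IsSignCircuit {α β : Type*} (σ : β → ℤˣ) (S : Graph α β) : Prop :=
  IsBalancedCircuit σ S ∨ IsBarbell σ S

/-- `𝓕` is a finite family (repetitions allowed) of sign-circuits of the signed graph `(G, σ)`. -/
def IsSignCircuitFamily {α β : Type*} (σ : β → ℤˣ) (G : Graph α β)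
    (𝓕 : Multiset (Graph α β)) : Prop :=
  ∀ S ∈ 𝓕, S ≤ G ∧ IsSignCircuit σ S

/-- Every edge of `H` lies in some member of `𝓕`. -/
def Covers {α β : Type*} (𝓕 : Multiset (Graph α β)) (H : Graph α β) : Prop :=
  ∀ e ∈ E(H), ∃ S ∈ 𝓕, e ∈ E(S)

/-- The length of a family is the sum of the numbers of edges of its members. -/
noncomputable def familyLength {α β : Type*} (𝓕 : Multiset (Graph α β)) : ℕ :=
  (𝓕.map fun S => E(S).ncard).sum

end Graph

/-! Each balanced circuit of `F` is used as it stands. The unbalanced circuits are even in number;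
they are paired off and each pair is covered by a barbell. The circuits of `F` use at most |V| edges
in all, and 10/9 |E| = 5/3 |V| because the graph is cubic, so the connecting paths may use 2/3 |V|
edges. They are cut out of one edge set `K` of that size (`CircuitPartition.exists_edges`) whose
mod-two boundary is a single vertex on each unbalanced circuit: such a set splits off edge-disjoint
paths pairing these vertices (`CircuitPartition.exists_barbells`).

To find `K`, view the circuits of `F` as contracted and let `U` be the set of unbalanced ones. A
`U`-join is a set of matching edges with odd degree exactly at the members of `U`. Thinning it
(`exists_isJoin_card_le`) leaves at most one edge per circuit met; arcs on each circuit `C` then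
repair the boundary, with at most |C|/2 edges since an arc set may be replaced by its complement. A
circuit that is met is thus charged at most ⌊|C|/2⌋ + 1, which is at most 2/3 |C| unless |C| is 2 or
4.

For `C` in `U`, the free choice of the end on `C` settles the exceptional lengths
(`exists_arcs_of_odd`). For the others the charge is averaged over all `U`-joins: no matching edge
is a bridge, so there are joins for the empty set meeting `C` in exactly two vertices
(`exists_toggle`), and adding them permutes the `U`-joins. Some join is then no worse than the
average, 2/3 |V|. -/

namespace Graph

/-! ### Mod-two boundaries and paths in multigraphs. -/

section

open scoped Graph Classical

variable {α β : Type*} {G : Graph α β} {K L : Finset β} {e : β} {u v x y z : α}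

/-- The number of ends of `e` at `z`, modulo two. -/
noncomputable def endParity (G : Graph α β) (e : β) (z : α) : ZMod 2 :=
  if G.IsNonloopAt e z then 1 else 0

/-- The mod-two boundary of a set of edges. -/
noncomputable def boundary (G : Graph α β) (K : Finset β) (z : α) : ZMod 2 :=
  ∑ e ∈ K, G.endParity e z

theorem IsLink.endParity_eq (h : G.IsLink e x y) (z : α) :
    G.endParity e z = (if z = x then 1 else 0) + (if z = y then 1 else 0) := by
  unfold endParity
  by_cases hxy : x = y
  · subst hxy
    rw [if_neg (IsLoopAt.not_isNonloopAt h z)]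
    split_ifs <;> decide
  · have hx : G.IsNonloopAt e x := ⟨y, Ne.symm hxy, h⟩
    have hy : G.IsNonloopAt e y := ⟨x, hxy, h.symm⟩
    by_cases h1 : z = x
    · subst h1; simp [hx, hxy]
    · by_cases h2 : z = y
      · subst h2; simp [hy, h1]
      · have : ¬ G.IsNonloopAt e z := by
          intro hz
          rcases hz.inc.eq_or_eq_of_isLink h with h3 | h3 <;> contradiction
        simp [this, h1, h2]

theorem sum_symmDiff_zmod_two {ι : Type*} (K L : Finset ι) (f : ι → ZMod 2) :
    ∑ e ∈ symmDiff K L, f e = ∑ e ∈ K, f e + ∑ e ∈ L, f e := by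
  have h1 : ∑ e ∈ K, f e = ∑ e ∈ K \ L, f e + ∑ e ∈ K ∩ L, f e := by
    rw [← Finset.sum_union (Finset.disjoint_sdiff_inter K L), Finset.sdiff_union_inter]
  have h2 : ∑ e ∈ L, f e = ∑ e ∈ L \ K, f e + ∑ e ∈ K ∩ L, f e := by
    rw [Finset.inter_comm K L, ← Finset.sum_union (Finset.disjoint_sdiff_inter L K),
      Finset.sdiff_union_inter]
  have h3 : Disjoint (K \ L) (L \ K) := disjoint_sdiff_sdiff
  rw [h1, h2, symmDiff_def, Finset.sup_eq_union, Finset.sum_union h3]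
  generalize ∑ e ∈ K ∩ L, f e = c
  have := CharTwo.add_self_eq_zero c
  linear_combination -this

theorem boundary_symmDiff (K L : Finset β) (z : α) :
    G.boundary (symmDiff K L) z = G.boundary K z + G.boundary L z :=
  sum_symmDiff_zmod_two _ _ _

@[simp] theorem boundary_empty (z : α) : G.boundary ∅ z = 0 := by simp [boundary]

theorem boundary_union (h : Disjoint K L) (z : α) :
    G.boundary (K ∪ L) z = G.boundary K z + G.boundary L z :=
  Finset.sum_union h

theorem boundary_sdiff (h : L ⊆ K) (z : α) :
    G.boundary (K \ L) z = G.boundary K z + G.boundary L z := by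
  rw [← boundary_symmDiff, symmDiff_def, Finset.sdiff_eq_empty_iff_subset.2 h]
  simp

theorem sum_endParity_eq_zero {X : Finset α}
    (hX : ∀ x y, G.IsLink e x y → (x ∈ X ↔ y ∈ X)) : ∑ z ∈ X, G.endParity e z = 0 := by
  by_cases he : e ∈ E(G)
  · obtain ⟨x, y, h⟩ := exists_isLink_of_mem_edgeSet he
    simp_rw [h.endParity_eq, Finset.sum_add_distrib, Finset.sum_ite_eq', hX x y h]
    exact CharTwo.add_self_eq_zero _
  · refine Finset.sum_eq_zero fun z _ => if_neg fun h => he h.edge_mem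

/-- Handshake argument: each edge of `K` has both ends in `X` or neither. It is applied to the
circuits of the factor and to the components of an edge set. -/
theorem sum_boundary_eq_zero {X : Finset α}
    (hX : ∀ e ∈ K, ∀ x y, G.IsLink e x y → (x ∈ X ↔ y ∈ X)) : ∑ z ∈ X, G.boundary K z = 0 := by
  unfold boundary
  rw [Finset.sum_comm]
  exact Finset.sum_eq_zero fun e he => sum_endParity_eq_zero (hX e he)

/-- Two vertices are adjacent through an edge of `P`. -/
def AdjIn (G : Graph α β) (P : Set β) (x y : α) : Prop := ∃ e ∈ P, G.IsLink e x y

theorem AdjIn.symm {P : Set β} (h : G.AdjIn P x y) : G.AdjIn P y x :=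
  let ⟨e, he, hl⟩ := h; ⟨e, he, hl.symm⟩

/-- `x 0, e 0, x 1, e 1, …, x n` is a path in `G` from `u` to `v` with edges in `P`. -/
structure IsPathSeq (G : Graph α β) (P : Set β) (u v : α) (n : ℕ) (x : ℕ → α) (e : ℕ → β) :
    Prop where
  head : x 0 = u
  last : x n = v
  inj : Set.InjOn x (Set.Iic n)
  mem : ∀ i < n, e i ∈ P
  link : ∀ i < n, G.IsLink (e i) (x i) (x (i + 1))

theorem exists_isPathSeq [hβ : Nonempty β] {P : Set β} (h : Relation.ReflTransGen (G.AdjIn P) u v) :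
    ∃ n x e, G.IsPathSeq P u v n x e := by
  -- Loops and multiplicities are forgotten to extract a simple path; an edge of `P` is then chosen
  -- for each step. The default edge occurs only beyond the end of the path.
  let H : SimpleGraph α := ⟨fun a b => a ≠ b ∧ G.AdjIn P a b,
    ⟨fun a b h => ⟨h.1.symm, h.2.symm⟩⟩, ⟨fun a h => h.1 rfl⟩⟩
  have hr : H.Reachable u v := by
    induction h with
    | refl => exact SimpleGraph.Reachable.refl _
    | @tail b c _ hbc ih =>
      by_cases hne : b = c
      · exact hne ▸ ih
      · exact ih.trans (SimpleGraph.Adj.reachable (show H.Adj b c from ⟨hne, hbc⟩))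
  obtain ⟨p, hp⟩ := hr.exists_isPath
  have hadj : ∀ i < p.length, ∃ e ∈ P, G.IsLink e (p.getVert i) (p.getVert (i + 1)) :=
    fun i hi => (p.adj_getVert_succ hi).2
  refine ⟨p.length, p.getVert, fun i => if hi : i < p.length then (hadj i hi).choose else hβ.some,
    p.getVert_zero, p.getVert_length, hp.getVert_injOn, fun i hi => ?_, fun i hi => ?_⟩
  · simp only [hi, dif_pos]
    exact (hadj i hi).choose_spec.1
  · simp only [hi, dif_pos]
    exact (hadj i hi).choose_spec.2

theorem IsLink.eq_and_eq_of_index {n : ℕ} {x : ℕ → α} {i j : ℕ} {e : β}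
    (hx : Set.InjOn x (Set.Iic n)) (hi : i < n) (hj : j < n)
    (h : G.IsLink e (x i) (x (i + 1))) (h' : G.IsLink e (x j) (x (j + 1))) : i = j := by
  have mem : ∀ k, k ≤ n → k ∈ Set.Iic n := fun k hk => hk
  rcases h.eq_and_eq_or_eq_and_eq h' with ⟨h1, -⟩ | ⟨h1, h2⟩
  · exact hx (mem _ (by omega)) (mem _ (by omega)) h1
  · have := hx (mem _ (by omega)) (mem _ (by omega)) h1
    have := hx (mem _ (by omega)) (mem _ (by omega)) h2
    omega

theorem IsPathSeq.injOn_edges {P : Set β} {n : ℕ} {x : ℕ → α} {e : ℕ → β}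
    (h : G.IsPathSeq P u v n x e) : Set.InjOn e (Finset.range n) := by
  intro i hi j hj hij
  simp only [Finset.coe_range, Set.mem_Iio] at hi hj
  exact (h.link i hi).eq_and_eq_of_index h.inj hi hj (hij ▸ h.link j hj)

/-- The set of edges of a path. -/
noncomputable def pathEdges (n : ℕ) (e : ℕ → β) : Finset β := (Finset.range n).image e

theorem IsPathSeq.card_pathEdges {P : Set β} {n : ℕ} {x : ℕ → α} {e : ℕ → β}
    (h : G.IsPathSeq P u v n x e) : (pathEdges n e).card = n := by
  rw [pathEdges, Finset.card_image_of_injOn h.injOn_edges, Finset.card_range]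

theorem IsPathSeq.pathEdges_subset {P : Set β} {n : ℕ} {x : ℕ → α} {e : ℕ → β}
    (h : G.IsPathSeq P u v n x e) : (pathEdges n e : Set β) ⊆ P := by
  intro f hf
  simp only [pathEdges, Finset.coe_image, Finset.coe_range, Set.mem_image, Set.mem_Iio] at hf
  obtain ⟨i, hi, rfl⟩ := hf
  exact h.mem i hi

theorem IsPathSeq.boundary_pathEdges {P : Set β} {n : ℕ} {x : ℕ → α} {e : ℕ → β}
    (h : G.IsPathSeq P u v n x e) (z : α) :
    G.boundary (pathEdges n e) z = (if z = u then 1 else 0) + (if z = v then 1 else 0) := by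
  rw [boundary, pathEdges, Finset.sum_image h.injOn_edges, ← h.head, ← h.last]
  have : ∀ m ≤ n, ∑ i ∈ Finset.range m, G.endParity (e i) z =
      (if z = x 0 then 1 else 0) + (if z = x m then 1 else 0) := by
    intro m
    induction m with
    | zero => intro _; simp [CharTwo.add_self_eq_zero]
    | succ m ih =>
      intro hm
      rw [Finset.sum_range_succ, ih (by omega), (h.link m (by omega)).endParity_eq]
      generalize (if z = x m then (1 : ZMod 2) else 0) = c
      have := CharTwo.add_self_eq_zero c
      linear_combination this
  exact this n le_rfl

theorem exists_boundary_eq_pair [Nonempty β] {P : Set β}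
    (h : Relation.ReflTransGen (G.AdjIn P) u v) :
    ∃ A : Finset β, (A : Set β) ⊆ P ∧
      ∀ z, G.boundary A z = (if z = u then 1 else 0) + (if z = v then 1 else 0) := by
  obtain ⟨n, x, e, hp⟩ := exists_isPathSeq h
  exact ⟨_, hp.pathEdges_subset, hp.boundary_pathEdges⟩

/-- An even set of vertices in a connected piece is the boundary of a set of edges. -/
theorem exists_boundary_eq_indicator [Nonempty β] {P : Set β} {S : Finset α}
    (hS : ∀ x ∈ S, ∀ y ∈ S, Relation.ReflTransGen (G.AdjIn P) x y) (heven : Even S.card) :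
    ∃ A : Finset β, (A : Set β) ⊆ P ∧ ∀ z, G.boundary A z = if z ∈ S then 1 else 0 := by
  rcases S.eq_empty_or_nonempty with rfl | ⟨r, hr⟩
  · exact ⟨∅, by simp, by simp⟩
  -- Every vertex of `T` is joined to the root `r`, where the parity of `T` accumulates; this extra
  -- term vanishes for the even set `S`.
  have key : ∀ T ⊆ S, ∃ A : Finset β, (A : Set β) ⊆ P ∧ ∀ z, G.boundary A z =
      (if z ∈ T then 1 else 0) + T.card * (if z = r then 1 else 0) := by
    intro T
    induction T using Finset.induction_on with
    | empty => exact fun _ => ⟨∅, by simp, by simp⟩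
    | @insert a T ha ih =>
      intro hT
      obtain ⟨A, hA, hAb⟩ := ih ((Finset.subset_insert _ _).trans hT)
      obtain ⟨B, hB, hBb⟩ := exists_boundary_eq_pair (hS a (hT (Finset.mem_insert_self _ _)) r hr)
      refine ⟨symmDiff A B, ?_, fun z => ?_⟩
      · intro f hf
        rcases Finset.mem_symmDiff.1 hf with h | h
        · exact hA h.1
        · exact hB h.1
      · rw [boundary_symmDiff, hAb, hBb, Finset.card_insert_of_notMem ha]
        by_cases hza : z = a
        · subst hza
          simp only [ha, if_false, Finset.mem_insert_self, if_true]
          push_cast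
          ring
        · simp only [hza, if_false, Finset.mem_insert, false_or]
          push_cast
          ring
  obtain ⟨A, hA, hAb⟩ := key S subset_rfl
  refine ⟨A, hA, fun z => ?_⟩
  rw [hAb, (ZMod.natCast_eq_zero_iff_even).2 heven]
  simp

end

end Graph

/-! ### Joins made of matching edges between the circuits of a factor. -/

namespace Graph

section

open scoped Graph Classical

variable {α β : Type*} {G : Graph α β} {K L J : Finset β} {e f : β} {u v w x y z : α}
  {C : Finset α} {U : Finset (Finset α)}

/-- The edge set of a finite graph split into a factor, whose components have as many edges as
vertices, and a perfect matching no edge of which is a bridge. -/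
structure CircuitPartition (G : Graph α β) where
  /-- the vertices of the graph -/
  verts : Finset α
  /-- the edges of the factor -/
  cyc : Finset β
  /-- the edges of the matching -/
  mat : Finset β
  /-- the vertex set of the component of the factor at a vertex -/
  part : α → Finset α
  mem_verts : ∀ x, x ∈ verts ↔ x ∈ V(G)
  mem_edges : ∀ e, e ∈ E(G) ↔ e ∈ cyc ∨ e ∈ mat
  disjoint : Disjoint cyc mat
  mem_part : ∀ x ∈ verts, ∀ y, y ∈ part x ↔ y ∈ verts ∧ part y = part x
  cyc_part : ∀ e ∈ cyc, ∀ x y, G.IsLink e x y → part x = part y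
  conn_part : ∀ x ∈ verts, ∀ y ∈ part x, Relation.ReflTransGen (G.AdjIn cyc) x y
  boundary_cyc : ∀ x ∈ verts, G.boundary cyc x = 0
  card_cyc : ∀ x ∈ verts, {e ∈ cyc | ∃ z ∈ part x, G.Inc e z}.card ≤ (part x).card
  -- Length four is the only one for which the positions of the vertices on the circuit matter.
  exists_adj : ∀ x ∈ verts, (part x).card = 4 → ∀ i ∈ part x, ∀ j ∈ part x,
    ∃ k ∈ part x, k ≠ i ∧ k ≠ j ∧ G.AdjIn cyc i k
  exists_mat : ∀ x ∈ verts, ∃ e ∈ mat, G.IsNonloopAt e x ∧ ∀ f ∈ mat, G.Inc f x → f = e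
  conn : ∀ e ∈ mat, ∀ x ∈ verts, ∀ y ∈ verts,
    Relation.ReflTransGen (G.AdjIn {f | f ∈ E(G) ∧ f ≠ e}) x y

theorem endParity_eq_zero_of_not_inc (h : ¬ G.Inc e z) : G.endParity e z = 0 :=
  if_neg fun h' => h h'.inc

theorem boundary_eq_zero_of_forall_not_inc (h : ∀ e ∈ K, ¬ G.Inc e z) : G.boundary K z = 0 :=
  Finset.sum_eq_zero fun e he => endParity_eq_zero_of_not_inc (h e he)

/-- A walk that enters `C` has an initial segment outside `C`. -/
theorem exists_first_entry {Q : Set β} (h : Relation.ReflTransGen (G.AdjIn Q) u v) (hu : u ∉ C)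
    (hv : v ∈ C) : ∃ x y, ∃ f ∈ Q, G.IsLink f x y ∧ x ∉ C ∧ y ∈ C ∧
      Relation.ReflTransGen (G.AdjIn {f | f ∈ Q ∧ ∀ z ∈ C, ¬ G.Inc f z}) u x := by
  have key : (∃ x y, ∃ f ∈ Q, G.IsLink f x y ∧ x ∉ C ∧ y ∈ C ∧
      Relation.ReflTransGen (G.AdjIn {f | f ∈ Q ∧ ∀ z ∈ C, ¬ G.Inc f z}) u x) ∨
      (v ∉ C ∧ Relation.ReflTransGen (G.AdjIn {f | f ∈ Q ∧ ∀ z ∈ C, ¬ G.Inc f z}) u v) := by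
    clear hv
    induction h with
    | refl => exact Or.inr ⟨hu, .refl⟩
    | @tail b c _ hbc ih =>
      rcases ih with h | ⟨hb, hub⟩
      · exact Or.inl h
      · obtain ⟨f, hf, hl⟩ := hbc
        by_cases hc : c ∈ C
        · exact Or.inl ⟨b, c, f, hf, hl, hb, hc, hub⟩
        · refine Or.inr ⟨hc, hub.tail ⟨f, ⟨hf, fun z hz hi => ?_⟩, hl⟩⟩
          rcases hi.eq_or_eq_of_isLink hl with rfl | rfl <;> contradiction
  exact key.resolve_right fun h => h.1 hv

namespace CircuitPartition

variable (D : CircuitPartition G)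

/-- The vertex sets of the components of the factor. -/
noncomputable def parts : Finset (Finset α) := D.verts.image D.part

/-- The edges of the factor that meet `C`. -/
noncomputable def edgesAt (C : Finset α) : Finset β := {e ∈ D.cyc | ∃ z ∈ C, G.Inc e z}

variable {D}

theorem mem_of_mem_parts (hC : C ∈ D.parts) : z ∈ C ↔ z ∈ D.verts ∧ D.part z = C := by
  obtain ⟨x, hx, rfl⟩ := Finset.mem_image.1 hC
  exact D.mem_part x hx z

theorem part_mem_parts (hx : x ∈ D.verts) : D.part x ∈ D.parts := Finset.mem_image_of_mem _ hx

theorem self_mem_part (hx : x ∈ D.verts) : x ∈ D.part x := (D.mem_part x hx x).2 ⟨hx, rfl⟩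

theorem nonempty_of_mem_parts (hC : C ∈ D.parts) : C.Nonempty := by
  obtain ⟨x, hx, rfl⟩ := Finset.mem_image.1 hC
  exact ⟨x, self_mem_part hx⟩

theorem mem_verts_of_inc (h : G.Inc e x) : x ∈ D.verts := (D.mem_verts x).2 h.vertex_mem

theorem mem_iff_of_cyc (hC : C ∈ D.parts) (he : e ∈ D.cyc) (h : G.IsLink e x y) :
    x ∈ C ↔ y ∈ C := by
  rw [mem_of_mem_parts hC, mem_of_mem_parts hC, D.cyc_part e he x y h]
  simp [mem_verts_of_inc h.inc_left, mem_verts_of_inc h.inc_right]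

theorem sum_boundary_cyc (hC : C ∈ D.parts) (hK : K ⊆ D.cyc) : ∑ z ∈ C, G.boundary K z = 0 :=
  sum_boundary_eq_zero fun _ he _ _ h => mem_iff_of_cyc hC (hK he) h

theorem boundary_filter_mat (hK : (K : Set β) ⊆ E(G)) (z : α) :
    G.boundary {e ∈ K | e ∈ D.mat} z = G.boundary K z + G.boundary {e ∈ K | e ∈ D.cyc} z := by
  rw [← boundary_sdiff (Finset.filter_subset _ _)]
  congr 1
  ext e
  have h1 := D.mem_edges e
  have h2 : e ∈ D.cyc → e ∉ D.mat := fun h => Finset.disjoint_left.1 D.disjoint h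
  have h3 : e ∈ K → e ∈ E(G) := fun h => hK h
  simp only [Finset.mem_filter, Finset.mem_sdiff]
  tauto

/-- Factor edges have boundary sum zero on every component, so discarding them does not change the
parity there: any edge set yields a set of matching edges with the same parities. -/
theorem sum_boundary_filter_mat (hK : (K : Set β) ⊆ E(G)) (hC : C ∈ D.parts) :
    ∑ z ∈ C, G.boundary {e ∈ K | e ∈ D.mat} z = ∑ z ∈ C, G.boundary K z := by
  simp_rw [boundary_filter_mat hK, Finset.sum_add_distrib]
  rw [sum_boundary_cyc hC (fun e he => (Finset.mem_filter.1 he).2), add_zero]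

theorem mat_subset : (D.mat : Set β) ⊆ E(G) := fun e he => (D.mem_edges e).2 (Or.inr he)

theorem cyc_subset : (D.cyc : Set β) ⊆ E(G) := fun e he => (D.mem_edges e).2 (Or.inl he)

theorem eq_of_mat_inc (he : e ∈ D.mat) (hf : f ∈ D.mat) (hex : G.Inc e x) (hfx : G.Inc f x) :
    e = f := by
  obtain ⟨g, -, -, h⟩ := D.exists_mat x (mem_verts_of_inc hex)
  rw [h e he hex, h f hf hfx]

theorem boundary_mat_eq_one_iff (hJ : J ⊆ D.mat) (hz : z ∈ D.verts) :
    G.boundary J z = 1 ↔ ∃ e ∈ J, G.Inc e z := by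
  constructor
  · intro h
    by_contra! hcon
    rw [boundary_eq_zero_of_forall_not_inc hcon] at h
    exact absurd h (by decide)
  · rintro ⟨e, he, hez⟩
    obtain ⟨g, -, hgz, h⟩ := D.exists_mat z hz
    have heg : e = g := h e (hJ he) hez
    rw [boundary, Finset.sum_eq_single_of_mem e he fun f hf hfe =>
      endParity_eq_zero_of_not_inc fun hi => hfe (eq_of_mat_inc (hJ hf) (hJ he) hi hez)]
    rw [heg]
    exact if_pos hgz

/-- A set of matching edges with even parity on all components that meets the component of `v`
exactly in `v` and one other vertex. -/
theorem exists_toggle [Nonempty β] (hv : v ∈ D.verts) :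
    ∃ A ⊆ D.mat, (∀ C ∈ D.parts, ∑ z ∈ C, G.boundary A z = 0) ∧ ∃ w ∈ D.part v, w ≠ v ∧
      ∀ z ∈ D.part v, G.boundary A z = (if z = v then 1 else 0) + (if z = w then 1 else 0) := by
  obtain ⟨e, he, ⟨v', hvv', hl⟩, -⟩ := D.exists_mat v hv
  have hC := part_mem_parts hv
  -- Passing to the matching edges of `K` preserves the boundary on the component of `v` vertex by
  -- vertex, because no factor edge of `K` touches it.
  suffices h : ∃ K : Finset β, (K : Set β) ⊆ E(G) ∧ (∀ f ∈ K, f ∈ D.cyc →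
      ∀ z ∈ D.part v, ¬ G.Inc f z) ∧ ∃ w ∈ D.part v, w ≠ v ∧
      ∀ z, G.boundary K z = (if z = v then 1 else 0) + (if z = w then 1 else 0) by
    obtain ⟨K, hKE, hKC, w, hw, hwv, hKb⟩ := h
    refine ⟨{e ∈ K | e ∈ D.mat}, fun e he => (Finset.mem_filter.1 he).2, fun C' hC' => ?_, w, hw,
      hwv, fun z hz => ?_⟩
    · rw [sum_boundary_filter_mat hKE hC']
      simp_rw [hKb, Finset.sum_add_distrib, Finset.sum_ite_eq']
      have : v ∈ C' ↔ w ∈ C' := by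
        have hw' := (mem_of_mem_parts hC).1 hw
        rw [mem_of_mem_parts hC', mem_of_mem_parts hC', hw'.2]
        simp [hv, hw'.1]
      rw [if_congr this rfl rfl]
      exact CharTwo.add_self_eq_zero _
    · rw [boundary_filter_mat hKE, hKb, boundary_eq_zero_of_forall_not_inc, add_zero]
      intro f hf
      exact hKC f (Finset.mem_filter.1 hf).1 (Finset.mem_filter.1 hf).2 z hz
  by_cases hv' : v' ∈ D.part v
  · refine ⟨{e}, by simpa using hl.edge_mem, fun f hf hfc => ?_, v', hv', hvv', fun z => ?_⟩
    · rw [Finset.mem_singleton.1 hf] at hfc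
      exact absurd he (Finset.disjoint_left.1 D.disjoint hfc)
    · simp [boundary, hl.endParity_eq]
  -- As `e` is not a bridge, a walk avoiding `e` leads from `v'` back to the component. It first
  -- enters through a matching edge `f`, at a vertex `y` that differs from `v` since `e` is the only
  -- matching edge at `v`. The excursion is `e`, a path outside, and `f`.
  · obtain ⟨x, y, f, ⟨hfE, hfe⟩, hfl, hx, hy, hr⟩ := exists_first_entry
      (D.conn e he v' (mem_verts_of_inc hl.inc_right) v hv) hv' (self_mem_part hv)
    obtain ⟨A, hA, hAb⟩ := exists_boundary_eq_pair hr
    have hfm : f ∈ D.mat := by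
      refine ((D.mem_edges f).1 hfE).resolve_left fun hfc => ?_
      exact hx ((mem_iff_of_cyc hC hfc hfl).2 hy)
    have hmem : ∀ g ∈ symmDiff A {e, f}, g ∈ A ∨ g = e ∨ g = f := by
      intro g hg
      simp only [Finset.mem_symmDiff, Finset.mem_insert, Finset.mem_singleton] at hg
      tauto
    refine ⟨symmDiff A {e, f}, fun g hg => ?_, fun g hg hgc => ?_, y, hy, ?_, fun z => ?_⟩
    · rcases hmem g hg with h | rfl | rfl
      · exact (hA h).1.1
      · exact hl.edge_mem
      · exact hfE
    · rcases hmem g hg with h | rfl | rfl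
      · exact (hA h).2
      · exact absurd he (Finset.disjoint_left.1 D.disjoint hgc)
      · exact absurd hfm (Finset.disjoint_left.1 D.disjoint hgc)
    · rintro rfl
      exact hfe (eq_of_mat_inc hfm he hfl.inc_right hl.inc_left)
    · rw [boundary_symmDiff, hAb, boundary, Finset.sum_pair (Ne.symm hfe), hl.endParity_eq,
        hfl.endParity_eq]
      have h1 := CharTwo.add_self_eq_zero (if z = v' then (1 : ZMod 2) else 0)
      have h2 := CharTwo.add_self_eq_zero (if z = x then (1 : ZMod 2) else 0)
      linear_combination h1 + h2

variable (D) in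
/-- A set of matching edges whose parity on a component is odd exactly for the members of `U`. -/
def IsJoin (U : Finset (Finset α)) (J : Finset β) : Prop :=
  J ⊆ D.mat ∧ ∀ C ∈ D.parts, ∑ z ∈ C, G.boundary J z = if C ∈ U then 1 else 0

theorem IsJoin.symmDiff (hJ : D.IsJoin U J) (hL : D.IsJoin ∅ L) :
    D.IsJoin U (symmDiff J L) := by
  refine ⟨fun e he => ?_, fun C hC => ?_⟩
  · rcases Finset.mem_symmDiff.1 he with h | h
    · exact hJ.1 h.1
    · exact hL.1 h.1
  · simp_rw [boundary_symmDiff, Finset.sum_add_distrib, hJ.2 C hC, hL.2 C hC]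
    simp

/-- One representative is taken on each member of `U`; an edge set with these as boundary exists by
connectedness, and its matching edges form the join. -/
theorem exists_isJoin [Nonempty α] [Nonempty β] (hU : U ⊆ D.parts) (heven : Even U.card) :
    ∃ J, D.IsJoin U J := by
  have hr : ∀ C ∈ U, ∃ x, x ∈ C := fun C hC => nonempty_of_mem_parts (hU hC)
  choose! r hr using hr
  have hpart : ∀ C ∈ U, r C ∈ D.verts ∧ D.part (r C) = C :=
    fun C hC => (mem_of_mem_parts (hU hC)).1 (hr C hC)
  have hinj : Set.InjOn r U := fun C hC C' hC' h => by
    rw [← (hpart C hC).2, ← (hpart C' hC').2, h]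
  obtain ⟨A, hA, hAb⟩ := exists_boundary_eq_indicator (G := G) (P := E(G)) (S := U.image r)
    (by
      intro x hx y hy
      obtain ⟨C, hC, rfl⟩ := Finset.mem_image.1 hx
      obtain ⟨C', hC', rfl⟩ := Finset.mem_image.1 hy
      obtain ⟨e, he, -⟩ := D.exists_mat _ (hpart C hC).1
      refine Relation.ReflTransGen.mono ?_ _ _ (D.conn e he _ (hpart C hC).1 _ (hpart C' hC').1)
      exact fun a b ⟨f, hf, hl⟩ => ⟨f, hf.1, hl⟩)
    (by rwa [Finset.card_image_of_injOn hinj])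
  refine ⟨{e ∈ A | e ∈ D.mat}, fun e he => (Finset.mem_filter.1 he).2, fun C hC => ?_⟩
  rw [sum_boundary_filter_mat hA hC]
  simp_rw [hAb]
  by_cases hCU : C ∈ U
  · rw [if_pos hCU, Finset.sum_eq_single_of_mem (r C) (hr C hCU)]
    · exact if_pos (Finset.mem_image_of_mem r hCU)
    · intro z hz hne
      refine if_neg fun h => ?_
      obtain ⟨C', hC', rfl⟩ := Finset.mem_image.1 h
      exact hne (by rw [← ((mem_of_mem_parts hC).1 hz).2, (hpart C' hC').2])
  · rw [if_neg hCU]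
    refine Finset.sum_eq_zero fun z hz => if_neg fun h => ?_
    obtain ⟨C', hC', rfl⟩ := Finset.mem_image.1 h
    rw [← ((mem_of_mem_parts hC).1 hz).2, (hpart C' hC').2] at hCU
    exact hCU hC'

/-- The ends in `C` of the edges of `J`. -/
noncomputable def hits (G : Graph α β) (J : Finset β) (C : Finset α) : Finset α :=
  {z ∈ C | G.boundary J z = 1}

/-- Each edge of `J` gives a vector over `ZMod 2` indexed by the components met. With more edges
than components there is a linear dependence; its support `B` is nonempty with even parity
everywhere, so it can be deleted. -/
theorem exists_isJoin_card_le (hJ : D.IsJoin U J) :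
    ∃ J₀ ⊆ J, D.IsJoin U J₀ ∧ J₀.card ≤ {C ∈ D.parts | (hits G J₀ C).Nonempty}.card := by
  induction hn : J.card using Nat.strong_induction_on generalizing J with
  | _ n ih =>
  by_cases hle : J.card ≤ {C ∈ D.parts | (hits G J C).Nonempty}.card
  · exact ⟨J, subset_rfl, hJ, hle⟩
  push Not at hle
  set H := {C ∈ D.parts | (hits G J C).Nonempty} with hH
  let vec : J → (H → ZMod 2) := fun e C => ∑ z ∈ C.1, G.endParity e z
  have hli : ¬ LinearIndependent (ZMod 2) vec := by
    intro h
    have := h.fintype_card_le_finrank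
    rw [Module.finrank_fintype_fun_eq_card, Fintype.card_coe, Fintype.card_coe] at this
    omega
  obtain ⟨g, hg, i, hi⟩ := Fintype.not_linearIndependent_iff.1 hli
  have h01 : ∀ a : ZMod 2, a ≠ 0 → a = 1 := by decide
  let B : Finset β := {e ∈ J | ∃ h : e ∈ J, g ⟨e, h⟩ = 1}
  have hBJ : B ⊆ J := Finset.filter_subset _ _
  have hB : ∀ C ∈ D.parts, ∑ z ∈ C, G.boundary B z = 0 := by
    intro C hC
    by_cases hCH : C ∈ H
    · have := congrFun hg ⟨C, hCH⟩
      simp only [Finset.sum_apply, Pi.smul_apply, smul_eq_mul, vec, Pi.zero_apply] at this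
      rw [← this]
      unfold boundary
      rw [Finset.sum_comm, Finset.sum_filter, ← Finset.sum_coe_sort]
      refine Finset.sum_congr rfl fun e _ => ?_
      by_cases he : g e = 1
      · simp [he]
      · have h0 : g e = 0 := by by_contra h; exact he (h01 _ h)
        simp [h0]
    · refine Finset.sum_eq_zero fun z hz => boundary_eq_zero_of_forall_not_inc fun e he hez => ?_
      refine hCH (Finset.mem_filter.2 ⟨hC, z, Finset.mem_filter.2 ⟨hz, ?_⟩⟩)
      exact (boundary_mat_eq_one_iff hJ.1 ((mem_of_mem_parts hC).1 hz).1).2 ⟨e, hBJ he, hez⟩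
  have hJB : D.IsJoin U (J \ B) := by
    refine ⟨Finset.sdiff_subset.trans hJ.1, fun C hC => ?_⟩
    simp_rw [boundary_sdiff hBJ, Finset.sum_add_distrib, hB C hC, add_zero]
    exact hJ.2 C hC
  have hlt : (J \ B).card < n := by
    rw [← hn]
    refine Finset.card_lt_card (Finset.sdiff_ssubset hBJ ⟨i, ?_⟩)
    exact Finset.mem_filter.2 ⟨i.2, i.2, h01 _ hi⟩
  obtain ⟨J₀, h1, h2, h3⟩ := ih _ hlt hJB rfl
  exact ⟨J₀, h1.trans Finset.sdiff_subset, h2, h3⟩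

end CircuitPartition

end

end Graph

/-! ### Arcs on the circuits and the cost of a join. -/

namespace Graph

section

open scoped Graph Classical

variable {α β : Type*} {G : Graph α β} {K L J : Finset β} {e f : β} {u v w x y z : α}
  {C S : Finset α} {U : Finset (Finset α)}

namespace CircuitPartition

variable {D : CircuitPartition G}

theorem mem_of_mem_edgesAt (hC : C ∈ D.parts) (he : e ∈ D.edgesAt C) (hz : G.Inc e z) :
    z ∈ C := by
  obtain ⟨hec, y, hy, hey⟩ := Finset.mem_filter.1 he
  obtain ⟨x, hl⟩ := hz
  rcases hey.eq_or_eq_of_isLink hl with rfl | rfl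
  · exact hy
  · exact (mem_iff_of_cyc hC hec hl).2 hy

theorem edgesAt_subset : D.edgesAt C ⊆ D.cyc := Finset.filter_subset _ _

theorem card_edgesAt_le (hC : C ∈ D.parts) : (D.edgesAt C).card ≤ C.card := by
  obtain ⟨x, hx, rfl⟩ := Finset.mem_image.1 hC
  exact D.card_cyc x hx

theorem boundary_of_subset_edgesAt (hC : C ∈ D.parts) (hK : K ⊆ D.edgesAt C) (hz : z ∉ C) :
    G.boundary K z = 0 :=
  boundary_eq_zero_of_forall_not_inc fun _ he hez => hz (mem_of_mem_edgesAt hC (hK he) hez)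

theorem boundary_inter_edgesAt (hK : K ⊆ D.cyc) (hz : z ∈ C) :
    G.boundary (K ∩ D.edgesAt C) z = G.boundary K z := by
  refine Finset.sum_subset Finset.inter_subset_left fun e he hn => ?_
  refine endParity_eq_zero_of_not_inc fun hi => hn (Finset.mem_inter.2 ⟨he, ?_⟩)
  exact Finset.mem_filter.2 ⟨hK he, z, hz, hi⟩

theorem boundary_edgesAt (hC : C ∈ D.parts) (z : α) : G.boundary (D.edgesAt C) z = 0 := by
  by_cases hz : z ∈ C
  · rw [← D.boundary_cyc z ((mem_of_mem_parts hC).1 hz).1, ← boundary_inter_edgesAt subset_rfl hz,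
      Finset.inter_eq_right.2 edgesAt_subset]
  · exact boundary_of_subset_edgesAt hC subset_rfl hz

variable (D) in
/-- A pair of vertices adjacent in the factor. -/
def IsAdjPair (S : Finset α) : Prop := ∃ i j, i ≠ j ∧ S = {i, j} ∧ G.AdjIn D.cyc i j

variable (D) in
/-- The number of edges of the component on `C` that suffice to join up the set `S`. -/
noncomputable def arcBound (C S : Finset α) : ℕ :=
  if S = ∅ then 0 else if D.IsAdjPair S then 1 else C.card / 2

theorem arcBound_le (hC : 2 ≤ C.card) (S : Finset α) : D.arcBound C S ≤ C.card / 2 := by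
  unfold arcBound
  split_ifs <;> omega

/-- The whole circuit has zero boundary, so an edge set of the circuit and its complement have the
same boundary, and one of them has at most half of the edges. -/
theorem exists_arcs [Nonempty β] (hC : C ∈ D.parts) (hS : S ⊆ C) (heven : Even S.card) :
    ∃ A ⊆ D.edgesAt C, (∀ z, G.boundary A z = if z ∈ S then 1 else 0) ∧
      A.card ≤ D.arcBound C S := by
  unfold arcBound
  split_ifs with h1 h2
  · exact ⟨∅, by simp, by simp [h1], by simp⟩
  · obtain ⟨i, j, hij, rfl, e, he, hl⟩ := h2
    refine ⟨{e}, ?_, fun z => ?_, by simp⟩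
    · rw [Finset.singleton_subset_iff]
      exact Finset.mem_filter.2 ⟨he, i, hS (by simp), hl.inc_left⟩
    · rw [boundary, Finset.sum_singleton, hl.endParity_eq]
      by_cases hzi : z = i
      · subst hzi; simp [hij]
      · simp [hzi]
  · obtain ⟨A, hA, hAb⟩ := exists_boundary_eq_indicator (G := G) (P := D.cyc) (S := S)
      (by
        intro x hx y hy
        have hx' := (mem_of_mem_parts hC).1 (hS hx)
        refine D.conn_part x hx'.1 y ?_
        rw [hx'.2]
        exact hS hy) heven
    have hA' : A ⊆ D.cyc := fun e he => hA he
    have hb : ∀ z, G.boundary (A ∩ D.edgesAt C) z = if z ∈ S then 1 else 0 := by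
      intro z
      by_cases hz : z ∈ C
      · rw [boundary_inter_edgesAt hA' hz, hAb]
      · rw [boundary_of_subset_edgesAt hC Finset.inter_subset_right hz,
          if_neg fun h => hz (hS h)]
    have hcard := card_edgesAt_le hC
    have hsub : A ∩ D.edgesAt C ⊆ D.edgesAt C := Finset.inter_subset_right
    have hcompl := Finset.card_sdiff_add_card_eq_card hsub
    by_cases hle : (A ∩ D.edgesAt C).card ≤ C.card / 2
    · exact ⟨_, hsub, hb, hle⟩
    · refine ⟨D.edgesAt C \ (A ∩ D.edgesAt C), Finset.sdiff_subset, fun z => ?_, by omega⟩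
      rw [boundary_sdiff hsub, boundary_edgesAt hC, zero_add, hb]

/-- Any `w` in `S` may be left as the free end while the others are joined up. If `S` is a single
vertex no arcs are needed. Otherwise ⌊|C|/2⌋ edges are few enough except when |C| = 4 and |S| = 3;
there `w` is chosen so that the other two are adjacent and one edge suffices. -/
theorem exists_arcs_of_odd [Nonempty β] (hC : C ∈ D.parts) (h2 : 2 ≤ C.card) (hS : S ⊆ C)
    (hodd : Odd S.card) : ∃ w ∈ C, ∃ A ⊆ D.edgesAt C,
      (∀ z, G.boundary A z = (if z ∈ S then 1 else 0) + (if z = w then 1 else 0)) ∧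
      3 * (A.card + 1) ≤ 2 * C.card := by
  have hle := Finset.card_le_card hS
  have erase : ∀ w ∈ S, ∃ A ⊆ D.edgesAt C,
      (∀ z, G.boundary A z = (if z ∈ S then 1 else 0) + (if z = w then 1 else 0)) ∧
      A.card ≤ D.arcBound C (S.erase w) := by
    intro w hw
    obtain ⟨A, hA, hAb, hAc⟩ := exists_arcs hC ((Finset.erase_subset w S).trans hS)
      (by rw [Finset.card_erase_of_mem hw]; exact Nat.Odd.sub_odd hodd odd_one)
    refine ⟨A, hA, fun z => ?_, hAc⟩
    rw [hAb]
    by_cases hz : z = w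
    · subst hz
      simp [hw, CharTwo.add_self_eq_zero]
    · simp [hz]
  by_cases h4 : S.card = 3 ∧ C.card = 4
  · obtain ⟨i, hi⟩ : S.Nonempty := Finset.card_pos.1 (by omega)
    -- `d` is the vertex of `C` missing from `S`; a neighbour of `i` other than `d` must lie in `S`.
    obtain ⟨d, hd⟩ : ∃ d, C \ S = {d} := Finset.card_eq_one.1 (by
      rw [Finset.card_sdiff_of_subset hS]; omega)
    have hdC : d ∈ C \ S := by simp [hd]
    obtain ⟨hi1, hi2⟩ := (mem_of_mem_parts hC).1 (hS hi)
    obtain ⟨k, hk, hki, hkd, hadj⟩ := D.exists_adj i hi1 (by rw [hi2]; exact h4.2) i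
      (self_mem_part hi1) d (by rw [hi2]; exact (Finset.mem_sdiff.1 hdC).1)
    rw [hi2] at hk
    have hkS : k ∈ S := by
      by_contra hkS
      have : k ∈ C \ S := Finset.mem_sdiff.2 ⟨hk, hkS⟩
      rw [hd, Finset.mem_singleton] at this
      exact hkd this
    have hsub : ({i, k} : Finset α) ⊆ S := by
      intro a ha
      rcases Finset.mem_insert.1 ha with rfl | ha
      · exact hi
      · rwa [Finset.mem_singleton.1 ha]
    obtain ⟨w, hw⟩ : ∃ w, S \ {i, k} = {w} := Finset.card_eq_one.1 (by
      rw [Finset.card_sdiff_of_subset hsub, Finset.card_pair hki.symm]; omega)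
    have hwS : w ∈ S \ {i, k} := by simp [hw]
    have her : S.erase w = {i, k} := by
      rw [← Finset.sdiff_singleton_eq_erase, ← hw, Finset.sdiff_sdiff_eq_self hsub]
    obtain ⟨A, hA, hAb, hAc⟩ := erase w (Finset.mem_sdiff.1 hwS).1
    refine ⟨w, hS (Finset.mem_sdiff.1 hwS).1, A, hA, hAb, ?_⟩
    have : D.arcBound C (S.erase w) = 1 := by
      rw [her, arcBound, if_neg (by simp), if_pos ⟨i, k, hki.symm, rfl, hadj⟩]
    omega
  · obtain ⟨w, hw⟩ : S.Nonempty := Finset.card_pos.1 hodd.pos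
    obtain ⟨A, hA, hAb, hAc⟩ := erase w hw
    refine ⟨w, hS hw, A, hA, hAb, ?_⟩
    by_cases h1 : S.card = 1
    · have : S.erase w = ∅ := Finset.card_eq_zero.1 (by rw [Finset.card_erase_of_mem hw, h1])
      rw [this, arcBound, if_pos rfl] at hAc
      omega
    · have := D.arcBound_le h2 (S.erase w)
      obtain ⟨m, hm⟩ := hodd
      omega

variable (D) in
/-- Three times the cost charged to the component on `C` when the matching edges end in `S`. -/
noncomputable def cost (U : Finset (Finset α)) (C S : Finset α) : ℕ :=
  if S = ∅ then 0 else if C ∈ U then 2 * C.card else 3 * (D.arcBound C S + 1)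

theorem card_hits (hJ : D.IsJoin U J) (hC : C ∈ D.parts) :
    ((hits G J C).card : ZMod 2) = if C ∈ U then 1 else 0 := by
  rw [← hJ.2 C hC, hits, Finset.card_filter]
  push_cast
  refine Finset.sum_congr rfl fun z _ => ?_
  generalize G.boundary J z = a
  revert a
  decide

theorem hits_subset : hits G J C ⊆ C := Finset.filter_subset _ _

/-- A component with one vertex would make its matching edge a bridge. -/
theorem two_le_card [Nonempty β] (hC : C ∈ D.parts) : 2 ≤ C.card := by
  obtain ⟨x, hx, rfl⟩ := Finset.mem_image.1 hC
  obtain ⟨A, -, -, w, hw, hwx, -⟩ := exists_toggle hx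
  exact Finset.one_lt_card.2 ⟨w, hw, x, self_mem_part hx, hwx⟩

theorem hits_mono (hJ : D.IsJoin U J) (hKJ : K ⊆ J) (hC : C ∈ D.parts) :
    hits G K C ⊆ hits G J C := by
  intro z hz
  obtain ⟨hzC, hz1⟩ := Finset.mem_filter.1 hz
  have hzv := ((mem_of_mem_parts hC).1 hzC).1
  obtain ⟨e, he, hez⟩ := (boundary_mat_eq_one_iff (hKJ.trans hJ.1) hzv).1 hz1
  exact Finset.mem_filter.2 ⟨hzC, (boundary_mat_eq_one_iff hJ.1 hzv).2 ⟨e, hKJ he, hez⟩⟩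

/-- This bounds what is built from a thinned join by the cost of the original join. Evenness is
needed when `T` is an adjacent pair: its only nonempty even subset is `T`, so the cheap bound is not
lost. -/
theorem cost_mono [Nonempty β] {S T : Finset α} (hC : C ∈ D.parts) (hST : S ⊆ T)
    (hS : C ∉ U → Even S.card) : D.cost U C S ≤ D.cost U C T := by
  have h2 := two_le_card hC
  by_cases hS0 : S = ∅
  · simp [cost, hS0]
  have hT0 : T ≠ ∅ := fun h => hS0 (Finset.subset_empty.1 (h ▸ hST))
  rw [cost, cost, if_neg hS0, if_neg hT0]
  split_ifs with hU
  · exact le_rfl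
  · by_cases hT : D.IsAdjPair T
    · obtain ⟨i, j, hij, hTe, -⟩ := id hT
      have hcT : T.card = 2 := by rw [hTe, Finset.card_pair hij]
      have hpos := Finset.card_pos.2 (Finset.nonempty_iff_ne_empty.2 hS0)
      obtain ⟨m, hm⟩ := hS hU
      rw [Finset.eq_of_subset_of_card_le hST (by omega)]
    · have : D.arcBound C T = C.card / 2 := by rw [arcBound, if_neg hT0, if_neg hT]
      have := D.arcBound_le h2 S
      omega

theorem even_card_hits (hJ : D.IsJoin U J) (hC : C ∈ D.parts) (hCU : C ∉ U) :
    Even (hits G J C).card := by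
  rw [← ZMod.natCast_eq_zero_iff_even, card_hits hJ hC, if_neg hCU]

/-- `K` consists of a thinned join and arcs on each component. The thinned join has at most one edge
per component it meets, which the `+ 1` in `cost` pays for. -/
theorem exists_edges_of_isJoin [Nonempty α] [Nonempty β] (hJ : D.IsJoin U J) :
    ∃ K : Finset β, (K : Set β) ⊆ E(G) ∧ ∃ w : Finset α → α, (∀ C ∈ D.parts, w C ∈ C) ∧
      (∀ z ∈ D.verts, G.boundary K z = if D.part z ∈ U ∧ z = w (D.part z) then 1 else 0) ∧
      3 * K.card ≤ ∑ C ∈ D.parts, D.cost U C (hits G J C) := by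
  obtain ⟨J₀, hJ₀J, hJ₀, hcard⟩ := exists_isJoin_card_le hJ
  have key : ∀ C ∈ D.parts, ∃ w ∈ C, ∃ A ⊆ D.edgesAt C, (∀ z, G.boundary A z =
      (if z ∈ hits G J₀ C then 1 else 0) + (if C ∈ U ∧ z = w then 1 else 0)) ∧
      3 * (A.card + (if (hits G J₀ C).Nonempty then 1 else 0)) ≤ D.cost U C (hits G J C) := by
    intro C hC
    have hmono := cost_mono (U := U) hC (hits_mono hJ hJ₀J hC) (even_card_hits hJ₀ hC)
    by_cases hCU : C ∈ U
    · have hodd : Odd (hits G J₀ C).card := by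
        rw [← ZMod.natCast_eq_one_iff_odd, card_hits hJ₀ hC, if_pos hCU]
      obtain ⟨w, hw, A, hA, hAb, hAc⟩ := exists_arcs_of_odd hC (two_le_card hC) hits_subset hodd
      refine ⟨w, hw, A, hA, fun z => by rw [hAb]; simp [hCU], le_trans ?_ hmono⟩
      have hne : (hits G J₀ C).Nonempty := Finset.card_pos.1 hodd.pos
      rw [if_pos hne, cost, if_neg hne.ne_empty, if_pos hCU]
      exact hAc
    · obtain ⟨A, hA, hAb, hAc⟩ := exists_arcs hC hits_subset (even_card_hits hJ₀ hC hCU)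
      obtain ⟨w, hw⟩ := nonempty_of_mem_parts hC
      refine ⟨w, hw, A, hA, fun z => by rw [hAb]; simp [hCU], le_trans ?_ hmono⟩
      rw [cost, if_neg hCU]
      by_cases hne : (hits G J₀ C).Nonempty
      · rw [if_pos hne, if_neg hne.ne_empty]
        omega
      · rw [if_neg hne]
        rw [Finset.not_nonempty_iff_eq_empty] at hne
        rw [hne, arcBound, if_pos rfl] at hAc
        omega
  choose! w hw A hA hAb hAc using key
  have hdisj : Disjoint J₀ (D.parts.biUnion A) := by
    rw [Finset.disjoint_biUnion_right]
    intro C hC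
    rw [Finset.disjoint_right]
    exact fun e he hej => Finset.disjoint_left.1 D.disjoint (edgesAt_subset (hA C hC he)) (hJ₀.1 hej)
  have hpair : (D.parts : Set (Finset α)).PairwiseDisjoint A := by
    intro C hC C' hC' hne
    rw [Function.onFun, Finset.disjoint_left]
    intro e he he'
    obtain ⟨-, z, hz, hez⟩ := Finset.mem_filter.1 (hA C hC he)
    have hz' := mem_of_mem_edgesAt hC' (hA C' hC' he') hez
    exact hne (by rw [← ((mem_of_mem_parts hC).1 hz).2, ← ((mem_of_mem_parts hC').1 hz').2])
  refine ⟨J₀ ∪ D.parts.biUnion A, ?_, w, hw, fun z hz => ?_, ?_⟩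
  · intro e he
    rcases Finset.mem_union.1 he with h | h
    · exact mat_subset (hJ₀.1 h)
    · obtain ⟨C, hC, h⟩ := Finset.mem_biUnion.1 h
      exact cyc_subset (edgesAt_subset (hA C hC h))
  · have hzp := part_mem_parts hz
    have hsum : G.boundary (D.parts.biUnion A) z = G.boundary (A (D.part z)) z := by
      rw [boundary, Finset.sum_biUnion hpair]
      refine Finset.sum_eq_single_of_mem _ hzp fun C hC hne => ?_
      refine boundary_of_subset_edgesAt hC (hA C hC) fun h => ?_
      exact hne ((mem_of_mem_parts hC).1 h).2.symm
    rw [boundary_union hdisj, hsum, hAb _ hzp]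
    have : (if z ∈ hits G J₀ (D.part z) then (1 : ZMod 2) else 0) = G.boundary J₀ z := by
      simp only [hits, Finset.mem_filter, self_mem_part hz, true_and]
      generalize G.boundary J₀ z = a
      revert a
      decide
    rw [this, ← add_assoc, CharTwo.add_self_eq_zero, zero_add]
  · rw [Finset.card_union_of_disjoint hdisj, Finset.card_biUnion hpair]
    have := Finset.sum_le_sum hAc
    rw [← Finset.mul_sum, Finset.sum_add_distrib, ← Finset.card_filter] at this
    omega

end CircuitPartition

end

end Graph

/-! ### Averaging the cost over all joins. -/

namespace Graph

section

open scoped Graph Classical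

variable {α β : Type*} {G : Graph α β} {K L J : Finset β} {e f : β} {u v w x y z : α}
  {C S : Finset α} {U : Finset (Finset α)}

namespace CircuitPartition

variable {D : CircuitPartition G}

variable (D) in
/-- All joins for `U`. -/
noncomputable def joins (U : Finset (Finset α)) : Finset (Finset β) :=
  {J ∈ D.mat.powerset | D.IsJoin U J}

theorem mem_joins : J ∈ D.joins U ↔ D.IsJoin U J := by
  simp only [joins, Finset.mem_filter, Finset.mem_powerset, and_iff_right_iff_imp]
  exact fun h => h.1

/-- Adding a fixed join for the empty set is an involution on the `U`-joins, so costs may be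
averaged over small orbits. -/
theorem sum_joins_symmDiff (hL : D.IsJoin ∅ L) (φ : Finset β → ℕ) :
    ∑ J ∈ D.joins U, φ (symmDiff J L) = ∑ J ∈ D.joins U, φ J := by
  refine Finset.sum_nbij' (fun J => symmDiff J L) (fun J => symmDiff J L) ?_ ?_ ?_ ?_ ?_
  · exact fun J hJ => mem_joins.2 ((mem_joins.1 hJ).symmDiff hL)
  · exact fun J hJ => mem_joins.2 ((mem_joins.1 hJ).symmDiff hL)
  · exact fun J _ => symmDiff_symmDiff_cancel_right L J
  · exact fun J _ => symmDiff_symmDiff_cancel_right L J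
  · exact fun _ _ => rfl

theorem cost_empty : D.cost U C ∅ = 0 := if_pos rfl

/-- The join `A` for the empty set meets `C` exactly in the two vertices `x` and `y`. -/
def Toggles (D : CircuitPartition G) (C : Finset α) (x y : α) (A : Finset β) : Prop :=
  D.IsJoin ∅ A ∧ ∀ z ∈ C, G.boundary A z = (if z = x then 1 else 0) + (if z = y then 1 else 0)

theorem exists_toggles [Nonempty β] (hC : C ∈ D.parts) (hv : v ∈ C) :
    ∃ w ∈ C, w ≠ v ∧ ∃ A, D.Toggles C v w A := by
  obtain ⟨hv', rfl⟩ := (mem_of_mem_parts hC).1 hv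
  obtain ⟨A, hA, hA0, w, hw, hwv, hAb⟩ := exists_toggle hv'
  exact ⟨w, hw, hwv, A, ⟨hA, fun C hC => by simp [hA0 C hC]⟩, hAb⟩

theorem Toggles.symm {A : Finset β} (h : D.Toggles C x y A) : D.Toggles C y x A :=
  ⟨h.1, fun z hz => by rw [h.2 z hz, add_comm]⟩

theorem Toggles.trans {A B : Finset β} (h : D.Toggles C x y A) (h' : D.Toggles C y z B) :
    D.Toggles C x z (symmDiff A B) := by
  refine ⟨h.1.symmDiff h'.1, fun t ht => ?_⟩
  rw [boundary_symmDiff, h.2 t ht, h'.2 t ht]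
  have := CharTwo.add_self_eq_zero (if t = y then (1 : ZMod 2) else 0)
  linear_combination this

theorem four_set_rotate (v w k l : α) : ({v, w, k, l} : Finset α) = {k, v, l, w} := by
  ext a
  simp only [Finset.mem_insert, Finset.mem_singleton]
  tauto

/-- Toggling is symmetric and transitive, and every vertex has a partner. The classes on four
vertices are therefore two pairs or everything, and both allow a splitting into two toggled pairs.
-/
theorem exists_toggles_pairs [Nonempty β] (hC : C ∈ D.parts) (h4 : C.card = 4) :
    ∃ i j k l, C = {i, j, k, l} ∧ i ≠ j ∧ i ≠ k ∧ i ≠ l ∧ j ≠ k ∧ j ≠ l ∧ k ≠ l ∧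
      (∃ A, D.Toggles C i j A) ∧ ∃ B, D.Toggles C k l B := by
  obtain ⟨v, hv⟩ := nonempty_of_mem_parts hC
  obtain ⟨w, hw, hwv, A, hA⟩ := exists_toggles hC hv
  have hsub : ({v, w} : Finset α) ⊆ C := by
    intro a ha
    rcases Finset.mem_insert.1 ha with rfl | ha
    · exact hv
    · rwa [Finset.mem_singleton.1 ha]
  obtain ⟨k, l, hkl, hs⟩ := Finset.card_eq_two.1
    (show (C \ {v, w}).card = 2 by
      rw [Finset.card_sdiff_of_subset hsub, Finset.card_pair hwv.symm, h4])
  have hCe : C = {v, w, k, l} := by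
    rw [← Finset.union_sdiff_of_subset hsub, hs, Finset.insert_union, Finset.singleton_union]
  have hk : k ∈ C \ {v, w} := by simp [hs]
  have hl : l ∈ C \ {v, w} := by simp [hs]
  simp only [Finset.mem_sdiff, Finset.mem_insert, Finset.mem_singleton, not_or] at hk hl
  obtain ⟨hkC, hkv, hkw⟩ := hk
  obtain ⟨hlC, hlv, hlw⟩ := hl
  obtain ⟨m, hm, hmk, B, hB⟩ := exists_toggles hC hkC
  obtain ⟨m', hm', hml, B', hB'⟩ := exists_toggles hC hlC
  have straight : (∃ B, D.Toggles C k l B) →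
      ∃ i j k l, C = {i, j, k, l} ∧ i ≠ j ∧ i ≠ k ∧ i ≠ l ∧ j ≠ k ∧ j ≠ l ∧ k ≠ l ∧
      (∃ A, D.Toggles C i j A) ∧ ∃ B, D.Toggles C k l B := fun h =>
    ⟨v, w, k, l, hCe, hwv.symm, Ne.symm hkv, Ne.symm hlv, Ne.symm hkw, Ne.symm hlw, hkl,
      ⟨A, hA⟩, h⟩
  have cross : ∀ a b, C = {k, a, l, b} → a ≠ b → k ≠ a → k ≠ b → l ≠ a → l ≠ b →
      (∃ A, D.Toggles C k a A) → (∃ A, D.Toggles C l b A) →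
      ∃ i j k l, C = {i, j, k, l} ∧ i ≠ j ∧ i ≠ k ∧ i ≠ l ∧ j ≠ k ∧ j ≠ l ∧ k ≠ l ∧
      (∃ A, D.Toggles C i j A) ∧ ∃ B, D.Toggles C k l B := fun a b h hab h1 h2 h3 h4 hA hB =>
    ⟨k, a, l, b, h, h1, hkl, h2, h3.symm, hab, h4, hA, hB⟩
  have hm1 : m = v ∨ m = w ∨ m = l := by
    have : m ∈ ({v, w, k, l} : Finset α) := hCe ▸ hm
    simp only [Finset.mem_insert, Finset.mem_singleton] at this
    tauto
  have hm2 : m' = v ∨ m' = w ∨ m' = k := by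
    have : m' ∈ ({v, w, k, l} : Finset α) := hCe ▸ hm'
    simp only [Finset.mem_insert, Finset.mem_singleton] at this
    tauto
  have e1 : C = {k, v, l, w} := hCe.trans (four_set_rotate v w k l)
  have e2 : C = {k, w, l, v} := hCe.trans ((Finset.insert_comm v w _).trans
    (four_set_rotate w v k l))
  rcases hm1 with rfl | rfl | rfl
  · rcases hm2 with rfl | rfl | rfl
    · exact straight ⟨_, hB.trans hB'.symm⟩
    · exact cross _ _ e1 hwv.symm hkv hkw hlv hlw ⟨_, hB⟩ ⟨_, hB'⟩
    · exact straight ⟨_, hB'.symm⟩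
  · rcases hm2 with rfl | rfl | rfl
    · exact cross _ _ e2 hwv hkw hkv hlw hlv ⟨_, hB⟩ ⟨_, hB'⟩
    · exact straight ⟨_, hB.trans hB'.symm⟩
    · exact straight ⟨_, hB'.symm⟩
  · exact straight ⟨_, hB⟩

/-- Toggling both vertices exchanges the joins that miss `C` with those that meet both, so two joins
together cost at most 0 + 6, within the allowed 2 · 4. -/
theorem sum_cost_le_of_card_two [Nonempty β] (hC : C ∈ D.parts) (h2 : C.card = 2) (hU : C ∉ U) :
    ∑ J ∈ D.joins U, D.cost U C (hits G J C) ≤ (D.joins U).card * (2 * C.card) := by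
  obtain ⟨v, hv⟩ := nonempty_of_mem_parts hC
  obtain ⟨w, hw, hwv, A, hA⟩ := exists_toggles hC hv
  have hCe : C = {v, w} := by
    symm
    refine Finset.eq_of_subset_of_card_le ?_ (by rw [h2, Finset.card_pair hwv.symm])
    intro a ha
    rcases Finset.mem_insert.1 ha with rfl | ha
    · exact hv
    · rwa [Finset.mem_singleton.1 ha]
  have hbound : ∀ S, D.cost U C S ≤ 6 := by
    intro S
    have := D.arcBound_le h2.ge S
    unfold cost
    split_ifs <;> omega
  have hpair : ∀ J ∈ D.joins U,
      D.cost U C (hits G J C) + D.cost U C (hits G (symmDiff J A) C) ≤ 8 := by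
    intro J hJ
    have h1 := hbound (hits G J C)
    have h2 := hbound (hits G (symmDiff J A) C)
    have hsum : G.boundary J v + G.boundary J w = 0 := by
      have := (mem_joins.1 hJ).2 C hC
      rwa [if_neg hU, hCe, Finset.sum_pair hwv.symm] at this
    by_cases hJv : G.boundary J v = 1
    · have : hits G (symmDiff J A) C = ∅ := by
        rw [hits, Finset.filter_eq_empty_iff]
        intro z hz
        have hJz : G.boundary J z = 1 := by
          rw [hCe, Finset.mem_insert, Finset.mem_singleton] at hz
          rcases hz with rfl | rfl
          · exact hJv
          · rw [hJv] at hsum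
            revert hsum
            generalize G.boundary J z = a
            revert a
            decide
        have hAz : G.boundary A z = 1 := by
          rw [hA.2 z hz]
          rw [hCe, Finset.mem_insert, Finset.mem_singleton] at hz
          rcases hz with rfl | rfl
          · simp [hwv.symm]
          · simp [hwv]
        rw [boundary_symmDiff, hJz, hAz]
        decide
      rw [this, cost_empty]
      omega
    · have : hits G J C = ∅ := by
        rw [hits, Finset.filter_eq_empty_iff]
        intro z hz hJz
        rw [hCe, Finset.mem_insert, Finset.mem_singleton] at hz
        rcases hz with rfl | rfl
        · exact hJv hJz
        · rw [hJz] at hsum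
          revert hsum hJv
          generalize G.boundary J v = a
          revert a
          decide
      rw [this, cost_empty]
      omega
  have h := Finset.sum_le_card_nsmul _ _ _ hpair
  rw [Finset.sum_add_distrib, sum_joins_symmDiff hA.1 (fun J => D.cost U C (hits G J C)),
    smul_eq_mul] at h
  rw [h2]
  omega

/-- With toggled pairs {i, j} and {k, l}, the orbit of `J` under `A` and `B` has four joins, with 4
· 8 = 32 allowed. If `J` meets {i, j} evenly, one of the four misses `C` and the total is at most 0
+ 3 · 9. Otherwise the hits are {i, k}, {i, l}, {j, k}, {j, l}; each of `i` and `j` is adjacent to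
`k` or `l`, so the total is at most 2 · (6 + 9). -/
theorem sum_cost_le_of_card_four [Nonempty β] (hC : C ∈ D.parts) (h4 : C.card = 4) (hU : C ∉ U) :
    ∑ J ∈ D.joins U, D.cost U C (hits G J C) ≤ (D.joins U).card * (2 * C.card) := by
  obtain ⟨i, j, k, l, hCe, hij, hik, hil, hjk, hjl, hkl, ⟨A, hA⟩, B, hB⟩ :=
    exists_toggles_pairs hC h4
  have hiC : i ∈ C := by simp [hCe]
  have hjC : j ∈ C := by simp [hCe]
  have hkC : k ∈ C := by simp [hCe]
  have hlC : l ∈ C := by simp [hCe]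
  have hbound : ∀ S, D.cost U C S ≤ 9 := by
    intro S
    have := D.arcBound_le (C := C) (by omega) S
    unfold cost
    split_ifs <;> omega
  have hadjb : ∀ a b, a ≠ b → D.cost U C {a, b} ≤ if G.AdjIn D.cyc a b then 6 else 9 := by
    intro a b hab
    split_ifs with h
    · rw [cost, if_neg (by simp), if_neg hU, arcBound, if_neg (by simp),
        if_pos ⟨a, b, hab, rfl, h⟩]
    · exact hbound _
  have hnbr : ∀ a ∈ C, ∀ b ∈ C, ∃ c ∈ C, c ≠ a ∧ c ≠ b ∧ G.AdjIn D.cyc a c := by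
    intro a ha b hb
    obtain ⟨ha', rfl⟩ := (mem_of_mem_parts hC).1 ha
    exact D.exists_adj a ha' h4 a ha b hb
  have hi : G.AdjIn D.cyc i k ∨ G.AdjIn D.cyc i l := by
    obtain ⟨c, hc, h1, h2, h3⟩ := hnbr i hiC j hjC
    rw [hCe] at hc
    simp only [Finset.mem_insert, Finset.mem_singleton] at hc
    rcases hc with rfl | rfl | rfl | rfl
    · exact absurd rfl h1
    · exact absurd rfl h2
    · exact Or.inl h3
    · exact Or.inr h3
  have hj : G.AdjIn D.cyc j k ∨ G.AdjIn D.cyc j l := by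
    obtain ⟨c, hc, h1, h2, h3⟩ := hnbr j hjC i hiC
    rw [hCe] at hc
    simp only [Finset.mem_insert, Finset.mem_singleton] at hc
    rcases hc with rfl | rfl | rfl | rfl
    · exact absurd rfl h2
    · exact absurd rfl h1
    · exact Or.inl h3
    · exact Or.inr h3
  have hempty : ∀ J, G.boundary J i = 0 → G.boundary J j = 0 → G.boundary J k = 0 →
      G.boundary J l = 0 → D.cost U C (hits G J C) = 0 := by
    intro J h1 h2 h3 h4
    have : hits G J C = ∅ := by
      rw [hits, Finset.filter_eq_empty_iff]
      intro z hz
      rw [hCe] at hz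
      simp only [Finset.mem_insert, Finset.mem_singleton] at hz
      rcases hz with rfl | rfl | rfl | rfl <;> simp [h1, h2, h3, h4]
    rw [this, cost_empty]
  have hpairb : ∀ J a b, a ∈ C → b ∈ C → a ≠ b → G.boundary J a = 1 → G.boundary J b = 1 →
      (∀ z ∈ C, z ≠ a → z ≠ b → G.boundary J z = 0) →
      D.cost U C (hits G J C) ≤ if G.AdjIn D.cyc a b then 6 else 9 := by
    intro J a b ha hb hab h1 h2 h3
    have : hits G J C = {a, b} := by
      ext z
      simp only [hits, Finset.mem_filter, Finset.mem_insert, Finset.mem_singleton]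
      constructor
      · rintro ⟨hz, hz1⟩
        by_contra! hne
        rw [h3 z hz hne.1 hne.2] at hz1
        exact absurd hz1 (by decide)
      · rintro (rfl | rfl)
        · exact ⟨ha, h1⟩
        · exact ⟨hb, h2⟩
    rw [this]
    exact hadjb a b hab
  have hsel : ∀ J, ∀ a ∈ C, ∀ a' ∈ C, ∀ b ∈ C, ∀ b' ∈ C, C = {a, a', b, b'} → a ≠ b →
      G.boundary J a = 1 → G.boundary J a' = 0 → G.boundary J b = 1 → G.boundary J b' = 0 →
      D.cost U C (hits G J C) ≤ if G.AdjIn D.cyc a b then 6 else 9 := by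
    intro J a ha a' ha' b hb b' hb' he hab h1 h2 h3 h4
    refine hpairb J a b ha hb hab h1 h3 fun z hz hza hzb => ?_
    rw [he] at hz
    simp only [Finset.mem_insert, Finset.mem_singleton] at hz
    rcases hz with rfl | rfl | rfl | rfl
    · exact absurd rfl hza
    · exact h2
    · exact absurd rfl hzb
    · exact h4
  have hfour : ∀ J ∈ D.joins U,
      (D.cost U C (hits G J C) + D.cost U C (hits G (symmDiff J A) C)) +
      (D.cost U C (hits G (symmDiff J B) C) +
        D.cost U C (hits G (symmDiff (symmDiff J B) A) C)) ≤ 32 := by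
    intro J hJ
    have hsum : G.boundary J i + G.boundary J j + G.boundary J k + G.boundary J l = 0 := by
      have := (mem_joins.1 hJ).2 C hC
      rw [if_neg hU, hCe, Finset.sum_insert (by simp [hij, hik, hil]),
        Finset.sum_insert (by simp [hjk, hjl]), Finset.sum_pair hkl] at this
      rw [← this]
      ring
    have hAi : G.boundary A i = 1 := by rw [hA.2 i hiC]; simp [hij]
    have hAj : G.boundary A j = 1 := by rw [hA.2 j hjC]; simp [hij.symm]
    have hAk : G.boundary A k = 0 := by rw [hA.2 k hkC]; simp [hik.symm, hjk.symm]
    have hAl : G.boundary A l = 0 := by rw [hA.2 l hlC]; simp [hil.symm, hjl.symm]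
    have hBi : G.boundary B i = 0 := by rw [hB.2 i hiC]; simp [hik, hil]
    have hBj : G.boundary B j = 0 := by rw [hB.2 j hjC]; simp [hjk, hjl]
    have hBk : G.boundary B k = 1 := by rw [hB.2 k hkC]; simp [hkl]
    have hBl : G.boundary B l = 1 := by rw [hB.2 l hlC]; simp [hkl.symm]
    have b1 := hbound (hits G J C)
    have b2 := hbound (hits G (symmDiff J A) C)
    have b3 := hbound (hits G (symmDiff J B) C)
    have b4 := hbound (hits G (symmDiff (symmDiff J B) A) C)
    have z1 := hempty J
    have z2 := hempty (symmDiff J A)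
    have z3 := hempty (symmDiff J B)
    have z4 := hempty (symmDiff (symmDiff J B) A)
    have ejk : C = {i, j, l, k} := by rw [hCe, Finset.pair_comm k l]
    have eij : C = {j, i, k, l} := by rw [hCe, Finset.insert_comm]
    have eij' : C = {j, i, l, k} := by rw [ejk, Finset.insert_comm]
    have s1 := fun J => hsel J i hiC j hjC k hkC l hlC hCe hik
    have s2 := fun J => hsel J i hiC j hjC l hlC k hkC ejk hil
    have s3 := fun J => hsel J j hjC i hiC k hkC l hlC eij hjk
    have s4 := fun J => hsel J j hjC i hiC l hlC k hkC eij' hjl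
    have hq : (if G.AdjIn D.cyc i k then 6 else 9) + (if G.AdjIn D.cyc i l then 6 else 9) ≤ 15 := by
      rcases hi with h | h <;> rw [if_pos h] <;> split_ifs <;> omega
    have hq' : (if G.AdjIn D.cyc j k then 6 else 9) + (if G.AdjIn D.cyc j l then 6 else 9) ≤ 15 := by
      rcases hj with h | h <;> rw [if_pos h] <;> split_ifs <;> omega
    have t1 := s1 J
    have t2 := s1 (symmDiff J A)
    have t3 := s1 (symmDiff J B)
    have t4 := s1 (symmDiff (symmDiff J B) A)
    have u1 := s2 J
    have u2 := s2 (symmDiff J A)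
    have u3 := s2 (symmDiff J B)
    have u4 := s2 (symmDiff (symmDiff J B) A)
    have v1 := s3 J
    have v2 := s3 (symmDiff J A)
    have v3 := s3 (symmDiff J B)
    have v4 := s3 (symmDiff (symmDiff J B) A)
    have w1 := s4 J
    have w2 := s4 (symmDiff J A)
    have w3 := s4 (symmDiff J B)
    have w4 := s4 (symmDiff (symmDiff J B) A)
    simp only [boundary_symmDiff, hAi, hAj, hAk, hAl, hBi, hBj, hBk, hBl] at *
    clear s1 s2 s3 s4 hsel hpairb hempty hadjb hnbr hbound
    have h01 : ∀ a : ZMod 2, a = 0 ∨ a = 1 := by decide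
    have two : (1 + 1 : ZMod 2) = 0 := by decide
    rcases h01 (G.boundary J i) with h1 | h1 <;> rcases h01 (G.boundary J j) with h2 | h2 <;>
      rcases h01 (G.boundary J k) with h3 | h3 <;> rcases h01 (G.boundary J l) with h4 | h4 <;>
      simp only [h1, h2, h3, h4, two, add_zero, zero_add, one_ne_zero, zero_ne_one, forall_const,
        IsEmpty.forall_iff] at * <;> omega
  have h := Finset.sum_le_card_nsmul _ _ _ hfour
  simp only [Finset.sum_add_distrib] at h
  rw [sum_joins_symmDiff hB.1 (fun J => D.cost U C (hits G (symmDiff J A) C)),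
    sum_joins_symmDiff hB.1 (fun J => D.cost U C (hits G J C)),
    sum_joins_symmDiff hA.1 (fun J => D.cost U C (hits G J C)), smul_eq_mul] at h
  rw [h4]
  omega

/-- Outside the two averaged cases every single cost is within the bound: 3(⌊n/2⌋ + 1) ≤ 2n for n =
3 and n ≥ 5. -/
theorem sum_cost_le [Nonempty β] (hC : C ∈ D.parts) :
    ∑ J ∈ D.joins U, D.cost U C (hits G J C) ≤ (D.joins U).card * (2 * C.card) := by
  have h2 := two_le_card hC
  by_cases h : C ∉ U ∧ C.card = 2
  · exact sum_cost_le_of_card_two hC h.2 h.1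
  by_cases h' : C ∉ U ∧ C.card = 4
  · exact sum_cost_le_of_card_four hC h'.2 h'.1
  rw [← smul_eq_mul]
  refine Finset.sum_le_card_nsmul _ _ _ fun J hJ => ?_
  have := D.arcBound_le h2 (hits G J C)
  unfold cost
  split_ifs with h3 h4
  · omega
  · omega
  · simp only [h4, not_false_eq_true, true_and] at h h'
    omega

theorem sum_card_parts : ∑ C ∈ D.parts, C.card = D.verts.card := by
  rw [Finset.card_eq_sum_card_fiberwise (f := D.part) (t := D.parts)
    fun x hx => part_mem_parts hx]
  refine Finset.sum_congr rfl fun C hC => congrArg _ ?_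
  ext z
  rw [mem_of_mem_parts hC, Finset.mem_filter]

/-- A set of edges of size at most two thirds of the number of vertices whose boundary picks one
vertex on each member of `U`. -/
theorem exists_edges [Nonempty α] [Nonempty β] (hU : U ⊆ D.parts) (heven : Even U.card) :
    ∃ K : Finset β, (K : Set β) ⊆ E(G) ∧ ∃ w : Finset α → α, (∀ C ∈ D.parts, w C ∈ C) ∧
      (∀ z ∈ D.verts, G.boundary K z = if D.part z ∈ U ∧ z = w (D.part z) then 1 else 0) ∧
      3 * K.card ≤ 2 * D.verts.card := by
  obtain ⟨J, hJ⟩ := exists_isJoin hU heven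
  have hle : ∑ J ∈ D.joins U, ∑ C ∈ D.parts, D.cost U C (hits G J C) ≤
      ∑ J ∈ D.joins U, 2 * D.verts.card := by
    rw [Finset.sum_comm, Finset.sum_const, smul_eq_mul, ← sum_card_parts, Finset.mul_sum,
      Finset.mul_sum]
    exact Finset.sum_le_sum fun C hC => sum_cost_le hC
  obtain ⟨J', hJ', hJ'le⟩ := Finset.exists_le_of_sum_le ⟨J, mem_joins.2 hJ⟩ hle
  obtain ⟨K, hK, w, hw, hKb, hKc⟩ := exists_edges_of_isJoin (mem_joins.1 hJ')
  exact ⟨K, hK, w, hw, hKb, hKc.trans hJ'le⟩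

end CircuitPartition

end

end Graph

/-! ### Degree counts, and the partition given by a two-factor of a cubic graph. -/

namespace Graph

section

open scoped Graph Classical

variable {α β : Type*} {G F H : Graph α β} {e f : β} {u v w x y z : α} {A : Finset β} {d : ℕ}

/-- The number of ends of `e` at `z`. -/
noncomputable def endCount (G : Graph α β) (e : β) (z : α) : ℕ :=
  (if G.IsNonloopAt e z then 1 else 0) + 2 * (if G.IsLoopAt e z then 1 else 0)

theorem IsLink.endCount_eq (h : G.IsLink e x y) (z : α) :
    G.endCount e z = (if z = x then 1 else 0) + (if z = y then 1 else 0) := by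
  unfold endCount
  by_cases hxy : x = y
  · subst hxy
    rw [if_neg (IsLoopAt.not_isNonloopAt h z)]
    by_cases hz : z = x
    · subst hz
      rw [if_pos (show G.IsLoopAt e z from h)]
      simp
    · rw [if_neg fun hl => hz (IsLoopAt.eq_of_inc h (IsLoopAt.inc hl)).symm]
      simp [hz]
  · have hx : G.IsNonloopAt e x := ⟨y, Ne.symm hxy, h⟩
    have hy : G.IsNonloopAt e y := ⟨x, hxy, h.symm⟩
    rw [if_neg (hx.not_isLoopAt z)]
    by_cases h1 : z = x
    · subst h1; simp [hx, hxy]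
    · by_cases h2 : z = y
      · subst h2; simp [hy, h1]
      · have : ¬ G.IsNonloopAt e z := by
          intro hz
          rcases hz.inc.eq_or_eq_of_isLink h with h3 | h3 <;> contradiction
        simp [this, h1, h2]

theorem sum_endCount_eq_two {X : Finset α} (h : G.IsLink e x y) (hx : x ∈ X) (hy : y ∈ X) :
    ∑ z ∈ X, G.endCount e z = 2 := by
  simp_rw [h.endCount_eq, Finset.sum_add_distrib, Finset.sum_ite_eq', if_pos hx, if_pos hy]

theorem sum_endCount_eq_card (A : Finset β) (x : α) :
    ∑ e ∈ A, G.endCount e x =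
      {e ∈ A | G.IsNonloopAt e x}.card + 2 * {e ∈ A | G.IsLoopAt e x}.card := by
  simp_rw [endCount, Finset.sum_add_distrib, ← Finset.mul_sum, ← Finset.card_filter]

theorem sum_endCount_eq_degree (hHG : H ≤ G) (hA : (A : Set β) = E(H)) (hd : H.degree x = d) :
    ∑ e ∈ A, G.endCount e x = d := by
  rw [sum_endCount_eq_card]
  have h1 : {e | H.IsNonloopAt e x} = ({e ∈ A | G.IsNonloopAt e x} : Finset β) := by
    ext e
    have hm : e ∈ A ↔ e ∈ E(H) := by rw [← hA]; exact Iff.rfl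
    simp only [Set.mem_ofPred_eq, Finset.coe_filter, hm]
    exact ⟨fun h => ⟨h.edge_mem, h.mono hHG⟩, fun h => (hHG.isNonloopAt_congr h.1).2 h.2⟩
  have h2 : {e | H.IsLoopAt e x} = ({e ∈ A | G.IsLoopAt e x} : Finset β) := by
    ext e
    have hm : e ∈ A ↔ e ∈ E(H) := by rw [← hA]; exact Iff.rfl
    simp only [Set.mem_ofPred_eq, Finset.coe_filter, hm]
    exact ⟨fun h => ⟨h.edge_mem, h.mono hHG⟩, fun h => (hHG.isLoopAt_congr h.1).2 h.2⟩
  rw [degree, h1, h2, Set.encard_coe_eq_coe_finsetCard, Set.encard_coe_eq_coe_finsetCard] at hd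
  exact_mod_cast hd

theorem endParity_eq_endCount (e : β) (z : α) : G.endParity e z = (G.endCount e z : ZMod 2) := by
  have two : (2 : ZMod 2) = 0 := by decide
  rw [endParity, endCount]
  push_cast
  rw [two, zero_mul, add_zero]

theorem reflTransGen_adj_symm (h : Relation.ReflTransGen F.Adj x y) :
    Relation.ReflTransGen F.Adj y x :=
  Relation.ReflTransGen.stdSymm.symm _ _ h

/-- The vertices of `X` in the component of `x`. -/
noncomputable def componentIn (F : Graph α β) (X : Finset α) (x : α) : Finset α :=
  {y ∈ X | Relation.ReflTransGen F.Adj x y}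

theorem componentIn_eq {X : Finset α} (h : Relation.ReflTransGen F.Adj x y) :
    F.componentIn X x = F.componentIn X y := by
  refine Finset.filter_congr fun z _ => ⟨fun hz => ?_, fun hz => h.trans hz⟩
  exact (reflTransGen_adj_symm h).trans hz

theorem componentIn_subset_of_closed {X Y : Finset α} (hx : x ∈ Y)
    (hY : ∀ a ∈ Y, ∀ b, F.Adj a b → b ∈ Y) : F.componentIn X x ⊆ Y := by
  intro y hy
  have h := (Finset.mem_filter.1 hy).2
  clear hy
  induction h with
  | refl => exact hx
  | tail _ hbc ih => exact hY _ ih _ hbc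

/-- In a graph in which `i` and `j` have degree two, either `i` has a neighbour outside `{i, j}`,
or the component of `i` lies in `{i, j}`. -/
theorem exists_adj_or_componentIn_subset {X : Finset α} {i j : α} (hA : (A : Set β) = E(F))
    (hi : F.degree i = (2 : ℕ)) (hj : F.degree j = (2 : ℕ)) :
    (∃ k, k ≠ i ∧ k ≠ j ∧ F.Adj i k) ∨ F.componentIn X i ⊆ {i, j} := by
  by_contra! hcon
  obtain ⟨hcon, hsub⟩ := hcon
  have hm : ∀ e, e ∈ A ↔ e ∈ E(F) := fun e => by rw [← hA]; exact Iff.rfl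
  have hdi := sum_endCount_eq_degree le_rfl hA hi
  have hdj := sum_endCount_eq_degree le_rfl hA hj
  rw [sum_endCount_eq_card] at hdi hdj
  have hnbr : ∀ k, F.Adj i k → k = i ∨ k = j := fun k hk => by
    by_contra! h
    exact hcon k h.1 h.2 hk
  by_cases hloop : ∃ e, F.IsLoopAt e i
  · obtain ⟨e, he⟩ := hloop
    have h1 : 0 < {e ∈ A | F.IsLoopAt e i}.card :=
      Finset.card_pos.2 ⟨e, Finset.mem_filter.2 ⟨(hm e).2 he.edge_mem, he⟩⟩
    have h2 : {e ∈ A | F.IsNonloopAt e i} = ∅ := Finset.card_eq_zero.1 (by omega)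
    refine hsub ((componentIn_subset_of_closed (Finset.mem_singleton_self i) ?_).trans (by simp))
    rintro a ha b ⟨f, hf⟩
    rw [Finset.mem_singleton] at ha ⊢
    subst ha
    by_contra hne
    exact Finset.notMem_empty f (h2 ▸ Finset.mem_filter.2 ⟨(hm f).2 hf.edge_mem, b, hne, hf⟩)
  · push Not at hloop
    have h1 : {e ∈ A | F.IsLoopAt e i} = ∅ := Finset.filter_eq_empty_iff.2 fun e _ => hloop e
    rw [h1, Finset.card_empty, mul_zero, add_zero] at hdi
    -- All edges at `i` go to `j` and already exhaust the degree of `j`, so no edge leaves {i, j}.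
    have hss : {e ∈ A | F.IsNonloopAt e i} ⊆ {e ∈ A | F.IsNonloopAt e j} := by
      intro f hf
      obtain ⟨hfA, k, hki, hl⟩ := Finset.mem_filter.1 hf
      have hkj := (hnbr k ⟨f, hl⟩).resolve_left hki
      subst hkj
      exact Finset.mem_filter.2 ⟨hfA, i, hki.symm, hl.symm⟩
    have hle := Finset.card_le_card hss
    have heq := Finset.eq_of_subset_of_card_le hss (by omega)
    have h2 : {e ∈ A | F.IsLoopAt e j} = ∅ := Finset.card_eq_zero.1 (by omega)
    refine hsub (componentIn_subset_of_closed (by simp) ?_)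
    rintro a ha b ⟨f, hf⟩
    rw [Finset.mem_insert, Finset.mem_singleton] at ha ⊢
    rcases ha with rfl | rfl
    · exact hnbr b ⟨f, hf⟩
    · by_cases hba : b = a
      · exact Or.inr hba
      · left
        have hmem : f ∈ {e ∈ A | F.IsNonloopAt e i} := by
          rw [heq]
          exact Finset.mem_filter.2 ⟨(hm f).2 hf.edge_mem, b, hba, hf⟩
        obtain ⟨-, hfi⟩ := Finset.mem_filter.1 hmem
        rcases hfi.inc.eq_or_eq_of_isLink hf with h | h
        · exact absurd ((hnbr b ⟨f, h ▸ hf⟩).elim (fun h' => h'.trans h) id) hba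
        · exact h.symm

theorem exists_circuitPartition (hV : V(G).Finite) (hE : E(G).Finite) (hcubic : G.IsCubic)
    (hconn : G.IsTwoEdgeConnected) (hF : F.IsTwoFactor G) :
    ∃ D : CircuitPartition G, (D.cyc : Set β) = E(F) := by
  have hFG : F ≤ G := hF.1.le
  have hVF : V(F) = V(G) := hF.1.vertexSet_eq
  have hEF : E(F) ⊆ E(G) := IsSubgraph.edgeSet_mono hFG
  have hfin := hE.subset hEF
  have hreg : ∀ x ∈ V(G), F.degree x = (2 : ℕ) := fun x hx => hF.2 x (hVF ▸ hx)
  have hmc : ∀ e, e ∈ hfin.toFinset ↔ e ∈ E(F) := fun e => hfin.mem_toFinset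
  have hmv : ∀ x, x ∈ hV.toFinset ↔ x ∈ V(G) := fun e => hV.mem_toFinset
  have hself : ∀ x ∈ V(G), x ∈ F.componentIn hV.toFinset x :=
    fun x hx => Finset.mem_filter.2 ⟨(hmv x).2 hx, .refl⟩
  have hcyc : ∀ e ∈ hfin.toFinset, ∀ x y, G.IsLink e x y → F.Adj x y :=
    fun e he x y h => ⟨e, (hFG.isLink_iff ((hmc e).1 he)).2 h⟩
  have hadj : ∀ x y, F.Adj x y → G.AdjIn hfin.toFinset x y :=
    fun x y ⟨e, he⟩ => ⟨e, (hmc e).2 he.edge_mem, he.mono hFG⟩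
  refine ⟨{
    verts := hV.toFinset
    cyc := hfin.toFinset
    mat := hE.toFinset \ hfin.toFinset
    part := F.componentIn hV.toFinset
    mem_verts := hmv
    mem_edges := fun e => ?_
    disjoint := disjoint_sdiff_self_right
    mem_part := fun x hx y => ?_
    cyc_part := fun e he x y h => componentIn_eq (.single (hcyc e he x y h))
    conn_part := fun x hx y hy => ?_
    boundary_cyc := fun x hx => ?_
    card_cyc := fun x hx => ?_
    exists_adj := fun x hx hcard i hi j hj => ?_
    exists_mat := fun x hx => ?_
    conn := fun e he x hx y hy => ?_ }, hfin.coe_toFinset⟩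
  · have h1 : e ∈ E(F) → e ∈ E(G) := fun h => hEF h
    rw [Finset.mem_sdiff, hmc, hE.mem_toFinset]
    tauto
  · constructor
    · intro hy
      obtain ⟨h1, h2⟩ := Finset.mem_filter.1 hy
      exact ⟨h1, (componentIn_eq h2).symm⟩
    · rintro ⟨h1, h2⟩
      rw [← h2]
      exact hself y ((hmv y).1 h1)
  · exact Relation.ReflTransGen.mono hadj _ _ (Finset.mem_filter.1 hy).2
  · simp_rw [boundary, endParity_eq_endCount]
    rw [← Nat.cast_sum, sum_endCount_eq_degree hFG hfin.coe_toFinset (hreg x ((hmv x).1 hx))]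
    decide
  -- Ends are counted twice over: two at each vertex of the component, and two for each factor edge
  -- meeting it, since both of its ends lie there.
  · have h1 : ∑ z ∈ F.componentIn hV.toFinset x, ∑ e ∈ hfin.toFinset, G.endCount e z =
        (F.componentIn hV.toFinset x).card * 2 := by
      rw [← smul_eq_mul]
      refine Finset.sum_eq_card_nsmul fun z hz => ?_
      exact sum_endCount_eq_degree hFG hfin.coe_toFinset
        (hreg z ((hmv z).1 (Finset.mem_filter.1 hz).1))
    rw [Finset.sum_comm] at h1
    have h2 : ∑ e ∈ {e ∈ hfin.toFinset | ∃ z ∈ F.componentIn hV.toFinset x, G.Inc e z},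
        ∑ z ∈ F.componentIn hV.toFinset x, G.endCount e z =
        {e ∈ hfin.toFinset | ∃ z ∈ F.componentIn hV.toFinset x, G.Inc e z}.card * 2 := by
      rw [← smul_eq_mul]
      refine Finset.sum_eq_card_nsmul fun e he => ?_
      obtain ⟨hec, z, hz, y, hl⟩ := Finset.mem_filter.1 he
      refine sum_endCount_eq_two hl hz (Finset.mem_filter.2 ⟨(hmv y).2 hl.right_mem, ?_⟩)
      exact (Finset.mem_filter.1 hz).2.tail (hcyc e hec z y hl)
    have h3 := Finset.sum_le_sum_of_subset (f := fun e => ∑ z ∈ F.componentIn hV.toFinset x,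
      G.endCount e z) (Finset.filter_subset
      (fun e => ∃ z ∈ F.componentIn hV.toFinset x, G.Inc e z) hfin.toFinset)
    omega
  · obtain ⟨hiv, hxi⟩ := Finset.mem_filter.1 hi
    obtain ⟨hjv, hxj⟩ := Finset.mem_filter.1 hj
    rcases exists_adj_or_componentIn_subset (X := hV.toFinset) hfin.coe_toFinset
      (hreg i ((hmv i).1 hiv)) (hreg j ((hmv j).1 hjv)) with ⟨k, hki, hkj, hk⟩ | hsub
    · refine ⟨k, Finset.mem_filter.2 ⟨(hmv k).2 (hVF ▸ hk.right_mem), hxi.tail hk⟩, hki, hkj, ?_⟩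
      exact hadj i k hk
    · have h1 := Finset.card_le_card hsub
      rw [← componentIn_eq hxi, hcard] at h1
      have := Finset.card_le_two (a := i) (b := j)
      omega
  -- Degree three less the two ends in `F` leaves one end, hence exactly one further edge, which is
  -- not a loop.
  · have h3 := sum_endCount_eq_degree le_rfl hE.coe_toFinset (hcubic x ((hmv x).1 hx))
    have h2 := sum_endCount_eq_degree hFG hfin.coe_toFinset (hreg x ((hmv x).1 hx))
    have hss : hfin.toFinset ⊆ hE.toFinset := by
      intro e he
      exact hE.mem_toFinset.2 (hEF ((hmc e).1 he))
    rw [← Finset.sum_sdiff hss, h2, sum_endCount_eq_card] at h3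
    obtain ⟨e, he⟩ := Finset.card_eq_one.1
      (show {e ∈ hE.toFinset \ hfin.toFinset | G.IsNonloopAt e x}.card = 1 by omega)
    have hl : {e ∈ hE.toFinset \ hfin.toFinset | G.IsLoopAt e x} = ∅ :=
      Finset.card_eq_zero.1 (by omega)
    have hemem := Finset.mem_filter.1 (he ▸ Finset.mem_singleton_self e :
      e ∈ {e ∈ hE.toFinset \ hfin.toFinset | G.IsNonloopAt e x})
    refine ⟨e, hemem.1, hemem.2, fun f hf hfx => ?_⟩
    rcases hfx.isLoopAt_or_isNonloopAt with h | h
    · exact absurd (hl ▸ Finset.mem_filter.2 ⟨hf, h⟩) (Finset.notMem_empty f)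
    · exact Finset.mem_singleton.1 (he ▸ Finset.mem_filter.2 ⟨hf, h⟩)
  · have heE : e ∈ E(G) := hE.mem_toFinset.1 (Finset.mem_sdiff.1 he).1
    have h := (hconn.2 e heE).2 x (by simpa using hx) y (by simpa using hy)
    refine Relation.ReflTransGen.mono ?_ _ _ h
    rintro a b ⟨f, hf⟩
    simp only [deleteEdges_isLink, Set.mem_singleton_iff] at hf
    exact ⟨f, ⟨hf.1.edge_mem, hf.2⟩, hf.1⟩

theorem three_mul_card_le (hV : V(G).Finite) (hE : E(G).Finite) (hcubic : G.IsCubic) :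
    3 * hV.toFinset.card ≤ 2 * E(G).ncard := by
  have h1 : ∑ z ∈ hV.toFinset, ∑ e ∈ hE.toFinset, G.endCount e z = hV.toFinset.card • 3 :=
    Finset.sum_eq_card_nsmul fun z hz =>
      sum_endCount_eq_degree le_rfl hE.coe_toFinset (hcubic z (hV.mem_toFinset.1 hz))
  have h2 : ∑ e ∈ hE.toFinset, ∑ z ∈ hV.toFinset, G.endCount e z = hE.toFinset.card • 2 := by
    refine Finset.sum_eq_card_nsmul fun e he => ?_
    obtain ⟨x, y, h⟩ := exists_isLink_of_mem_edgeSet (hE.mem_toFinset.1 he)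
    exact sum_endCount_eq_two h (hV.mem_toFinset.2 h.left_mem) (hV.mem_toFinset.2 h.right_mem)
  rw [Finset.sum_comm, h2, smul_eq_mul, smul_eq_mul] at h1
  rw [Set.ncard_eq_toFinset_card _ hE]
  omega

end

end Graph

/-! ### Barbells and the final cover. -/

namespace Graph

section

open scoped Graph Classical

variable {α β : Type*} {G F H : Graph α β} {e f : β} {u v w x y z : α} {K : Finset β}
  {C C₁ C₂ : Finset α} {σ : β → ℤˣ}

/-- The subgraph with vertex set `X` and those edges of `Y` that have both ends in `X`. -/
def sub (G : Graph α β) (X : Set α) (Y : Set β) : Graph α β := (G.restrict Y).induce X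

theorem sub_isLink {X : Set α} {Y : Set β} :
    (G.sub X Y).IsLink e x y ↔ (e ∈ Y ∧ G.IsLink e x y) ∧ x ∈ X ∧ y ∈ X := by
  simp [sub]

theorem edgeSet_sub {X : Set α} {Y : Set β} (hY : Y ⊆ E(G))
    (h : ∀ e ∈ Y, ∀ x y, G.IsLink e x y → x ∈ X) : E(G.sub X Y) = Y := by
  ext e
  rw [edge_mem_iff_exists_isLink]
  constructor
  · rintro ⟨x, y, hl⟩
    exact (sub_isLink.1 hl).1.1
  · intro he
    obtain ⟨x, y, hl⟩ := exists_isLink_of_mem_edgeSet (hY he)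
    exact ⟨x, y, sub_isLink.2 ⟨⟨he, hl⟩, h e he x y hl, h e he y x hl.symm⟩⟩

theorem sub_le {X : Set α} {Y : Set β} (hX : X ⊆ V(G)) : G.sub X Y ≤ G :=
  ⟨hX, fun _ _ _ h => (sub_isLink.1 h).1.2⟩

theorem le_sub {X : Set α} {Y : Set β} (hHG : H ≤ G) (hX : V(H) ⊆ X) (hY : E(H) ⊆ Y) :
    H ≤ G.sub X Y :=
  ⟨hX, fun _ _ _ h => sub_isLink.2
    ⟨⟨hY h.edge_mem, h.mono hHG⟩, hX h.left_mem, hX h.right_mem⟩⟩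

namespace CircuitPartition

variable {D : CircuitPartition G}

theorem isLink_of_mem_cyc (hFG : F ≤ G) (hcyc : (D.cyc : Set β) = E(F)) :
    F.IsLink e x y ↔ e ∈ D.cyc ∧ G.IsLink e x y := by
  have hm : e ∈ D.cyc ↔ e ∈ E(F) := by rw [← hcyc]; exact Iff.rfl
  rw [hm]
  exact ⟨fun h => ⟨h.edge_mem, h.mono hFG⟩, fun h => (hFG.isLink_iff h.1).2 h.2⟩

theorem mem_iff_of_isLink (hFG : F ≤ G) (hcyc : (D.cyc : Set β) = E(F)) (hC : C ∈ D.parts)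
    (h : F.IsLink e x y) : x ∈ C ↔ y ∈ C := by
  obtain ⟨he, hl⟩ := (isLink_of_mem_cyc hFG hcyc).1 h
  exact mem_iff_of_cyc hC he hl

theorem edgeSet_induce_part (hFG : F ≤ G) (hcyc : (D.cyc : Set β) = E(F)) (hC : C ∈ D.parts) :
    E(F.induce (C : Set α)) = D.edgesAt C := by
  ext e
  rw [edge_mem_iff_exists_isLink]
  simp only [induce_isLink, edgesAt, Finset.coe_filter, Set.mem_ofPred_eq]
  constructor
  · rintro ⟨x, y, hl, hx, hy⟩
    obtain ⟨he, hl⟩ := (isLink_of_mem_cyc hFG hcyc).1 hl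
    exact ⟨he, x, hx, hl.inc_left⟩
  · rintro ⟨he, x, hx, y, hl⟩
    exact ⟨x, y, (isLink_of_mem_cyc hFG hcyc).2 ⟨he, hl⟩, hx, (mem_iff_of_cyc hC he hl).1 hx⟩

theorem induce_part_le (hF : F.IsTwoFactor G) (hC : C ∈ D.parts) :
    F.induce (C : Set α) ≤ G := by
  refine (induce_le fun z hz => ?_).trans hF.1.le
  rw [hF.1.vertexSet_eq]
  exact (D.mem_verts z).1 ((mem_of_mem_parts hC).1 hz).1

theorem isCircuit_induce_part (hF : F.IsTwoFactor G) (hcyc : (D.cyc : Set β) = E(F))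
    (hC : C ∈ D.parts) : (F.induce (C : Set α)).IsCircuit := by
  refine ⟨⟨nonempty_of_mem_parts hC, fun x hx y hy => ?_⟩, fun x hx => ?_⟩
  · have hx' := (mem_of_mem_parts hC).1 hx
    have h := D.conn_part x hx'.1 y (by rw [hx'.2]; exact hy)
    have key : Relation.ReflTransGen (F.induce (C : Set α)).Adj x y ∧ y ∈ C := by
      clear hy
      induction h with
      | refl => exact ⟨.refl, hx⟩
      | @tail b c _ hbc ih =>
        obtain ⟨e, he, hl⟩ := hbc
        have hc := (mem_iff_of_cyc hC he hl).1 ih.2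
        refine ⟨ih.1.tail ⟨e, ?_⟩, hc⟩
        rw [induce_isLink]
        exact ⟨(isLink_of_mem_cyc hF.1.le hcyc).2 ⟨he, hl⟩, ih.2, hc⟩
    exact key.1
  · have hxC : x ∈ C := hx
    have hxV : x ∈ V(F) := by
      rw [hF.1.vertexSet_eq]
      exact (D.mem_verts x).1 ((mem_of_mem_parts hC).1 hxC).1
    rw [← hF.2 x hxV]
    have hl : ∀ e y, (F.induce (C : Set α)).IsLink e x y ↔ F.IsLink e x y := by
      intro e y
      rw [induce_isLink]
      exact ⟨fun h => h.1, fun h => ⟨h, hxC, (mem_iff_of_isLink hF.1.le hcyc hC h).1 hxC⟩⟩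
    simp only [degree, IsNonloopAt, IsLoopAt, hl]

variable (D F σ) in
/-- The vertex sets of the unbalanced components of `F`. -/
noncomputable def unbalanced : Finset (Finset α) :=
  {C ∈ D.parts | Odd (negativeEdges σ (F.induce (C : Set α))).ncard}

theorem negativeEdges_induce_part (hFG : F ≤ G) (hcyc : (D.cyc : Set β) = E(F))
    (hC : C ∈ D.parts) : negativeEdges σ (F.induce (C : Set α)) =
      ({e ∈ D.edgesAt C | σ e = -1} : Finset β) := by
  rw [negativeEdges, edgeSet_induce_part hFG hcyc hC]
  ext e
  simp

/-- The negative edges of `F` are distributed over its components, so their number has the parity of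
the number of odd components. -/
theorem even_card_unbalanced (hFG : F ≤ G) (hcyc : (D.cyc : Set β) = E(F))
    (heven : Even (negativeEdges σ F).ncard) : Even (D.unbalanced F σ).card := by
  have hneg : negativeEdges σ F =
      (D.parts.biUnion fun C => {e ∈ D.edgesAt C | σ e = -1} : Finset β) := by
    ext e
    simp only [negativeEdges, ← hcyc, Set.mem_ofPred_eq, Finset.mem_coe, Finset.mem_biUnion,
      Finset.mem_filter]
    constructor
    · rintro ⟨he, hs⟩
      obtain ⟨x, y, hl⟩ := exists_isLink_of_mem_edgeSet (cyc_subset he)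
      have hx := mem_verts_of_inc (D := D) hl.inc_left
      exact ⟨_, part_mem_parts hx,
        Finset.mem_filter.2 ⟨he, x, self_mem_part hx, hl.inc_left⟩, hs⟩
    · rintro ⟨C, -, he, hs⟩
      exact ⟨edgesAt_subset he, hs⟩
  rw [hneg, Set.ncard_coe_finset, Finset.card_biUnion, ← Nat.not_odd_iff_even,
    Finset.odd_sum_iff_odd_card_odd, Nat.not_odd_iff_even] at heven
  · rw [unbalanced]
    convert heven using 2
    refine Finset.filter_congr fun C hC => ?_
    rw [negativeEdges_induce_part hFG hcyc hC, Set.ncard_coe_finset]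
  · intro C hC C' hC' hne
    rw [Function.onFun, Finset.disjoint_left]
    intro e he he'
    obtain ⟨-, z, hz, hez⟩ := Finset.mem_filter.1 (Finset.mem_filter.1 he).1
    have hz' := mem_of_mem_edgesAt hC' (Finset.mem_filter.1 he').1 hez
    exact hne (by rw [← ((mem_of_mem_parts hC).1 hz).2, ← ((mem_of_mem_parts hC').1 hz').2])

/-- Distinct components of the factor are disjoint, so the path is nontrivial and only long barbells
arise. -/
theorem exists_barbell_of_path (hF : F.IsTwoFactor G) (hcyc : (D.cyc : Set β) = E(F))
    (hC₁ : C₁ ∈ D.unbalanced F σ) (hC₂ : C₂ ∈ D.unbalanced F σ) (hne : C₁ ≠ C₂) {n : ℕ}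
    {x : ℕ → α} {e : ℕ → β} (hp : G.IsPathSeq E(G) u v n x e)
    (h₁ : ∀ i ≤ n, x i ∈ C₁ ↔ i = 0) (h₂ : ∀ i ≤ n, x i ∈ C₂ ↔ i = n) :
    ∃ B ≤ G, IsBarbell σ B ∧ (D.edgesAt C₁ : Set β) ⊆ E(B) ∧ (D.edgesAt C₂ : Set β) ⊆ E(B) ∧
      E(B).ncard ≤ n + (C₁.card + C₂.card) := by
  obtain ⟨hP₁, hodd₁⟩ := Finset.mem_filter.1 hC₁
  obtain ⟨hP₂, hodd₂⟩ := Finset.mem_filter.1 hC₂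
  have hE₁ := edgeSet_induce_part hF.1.le hcyc hP₁
  have hE₂ := edgeSet_induce_part hF.1.le hcyc hP₂
  have hdisj : ∀ z, z ∈ C₁ → z ∉ C₂ := fun z hz hz' =>
    hne (by rw [← ((mem_of_mem_parts hP₁).1 hz).2, ← ((mem_of_mem_parts hP₂).1 hz').2])
  have hle₁ := induce_part_le hF hP₁
  have hle₂ := induce_part_le hF hP₂
  set A₁ := F.induce (C₁ : Set α)
  set A₂ := F.induce (C₂ : Set α)
  let x' : Fin (n + 1) → α := fun i => x i
  let e' : Fin n → β := fun i => e i
  have hx0 : x 0 ∈ C₁ := (h₁ 0 (Nat.zero_le _)).2 rfl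
  have hxn : x n ∈ C₂ := (h₂ n le_rfl).2 rfl
  have hn : n ≠ 0 := fun h => hdisj _ hx0 (h ▸ hxn)
  have hxV : Set.range x' ⊆ V(G) := by
    rintro _ ⟨i, rfl⟩
    by_cases hi : (i : ℕ) < n
    · exact (hp.link i hi).left_mem
    · have : (i : ℕ) = n := by omega
      change x i ∈ V(G)
      rw [this]
      exact (D.mem_verts _).1 ((mem_of_mem_parts hP₂).1 hxn).1
  have heG : Set.range e' ⊆ E(G) := by
    rintro _ ⟨i, rfl⟩
    exact hp.mem i i.2
  have hclosed : ∀ f ∈ Set.range e', ∀ a b, G.IsLink f a b → a ∈ Set.range x' := by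
    rintro _ ⟨i, rfl⟩ a b hl
    rcases hl.left_eq_or_eq (hp.link i i.2) with rfl | rfl
    · exact ⟨i.castSucc, rfl⟩
    · exact ⟨i.succ, rfl⟩
  set P := G.sub (Set.range x') (Set.range e') with hPdef
  have hPle : P ≤ G := sub_le hxV
  have hPE : E(P) = Set.range e' := edgeSet_sub heG hclosed
  have hPpath : P.IsPathBetween (x 0) (x n) := by
    refine ⟨n, x', e', fun i j hij => Fin.ext (hp.inj (Set.mem_Iic.2 (by omega))
      (Set.mem_Iic.2 (by omega)) hij), rfl, rfl, fun i => ?_, rfl, hPE⟩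
    exact sub_isLink.2 ⟨⟨⟨i, rfl⟩, hp.link i i.2⟩, ⟨i.castSucc, rfl⟩, ⟨i.succ, rfl⟩⟩
  have hBE : E(G.sub (V(A₁) ∪ V(A₂) ∪ V(P)) (E(A₁) ∪ E(A₂) ∪ E(P))) = E(A₁) ∪ E(A₂) ∪ E(P) := by
    refine edgeSet_sub ?_ ?_
    · exact Set.union_subset (Set.union_subset (IsSubgraph.edgeSet_mono hle₁)
        (IsSubgraph.edgeSet_mono hle₂)) (IsSubgraph.edgeSet_mono hPle)
    · rintro f ((hf | hf) | hf) a b hl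
      · exact Or.inl (Or.inl ((hle₁.isLink_iff hf).2 hl).left_mem)
      · exact Or.inl (Or.inr ((hle₂.isLink_iff hf).2 hl).left_mem)
      · exact Or.inr ((hPle.isLink_iff hf).2 hl).left_mem
  refine ⟨G.sub (V(A₁) ∪ V(A₂) ∪ V(P)) (E(A₁) ∪ E(A₂) ∪ E(P)),
    sub_le (Set.union_subset (Set.union_subset hle₁.vertexSet_mono hle₂.vertexSet_mono)
    hPle.vertexSet_mono), ⟨A₁, A₂, P, x 0, x n,
      ⟨isCircuit_induce_part hF hcyc hP₁, hodd₁⟩, ⟨isCircuit_induce_part hF hcyc hP₂, hodd₂⟩,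
      hPpath, le_sub hle₁ (fun z hz => Or.inl (Or.inl hz)) (fun z hz => Or.inl (Or.inl hz)),
      le_sub hle₂ (fun z hz => Or.inl (Or.inr hz)) (fun z hz => Or.inl (Or.inr hz)),
      le_sub hPle (fun z hz => Or.inr hz) (fun z hz => Or.inr hz), rfl, hBE, ?_, ?_,
      Or.inr ⟨fun h => hdisj _ hx0 (h ▸ hxn), ?_⟩⟩, ?_, ?_, ?_⟩
  · ext z
    constructor
    · rintro ⟨hz, i, rfl⟩
      exact congrArg x ((h₁ i (by omega)).1 hz)
    · intro hz
      rw [Set.mem_singleton_iff.1 hz]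
      exact ⟨hx0, 0, rfl⟩
  · ext z
    constructor
    · rintro ⟨hz, i, rfl⟩
      exact congrArg x ((h₂ i (by omega)).1 hz)
    · intro hz
      rw [Set.mem_singleton_iff.1 hz]
      exact ⟨hxn, Fin.last n, rfl⟩
  · exact Set.eq_empty_of_forall_notMem fun z hz => hdisj z hz.1 hz.2
  · rw [hBE, ← hE₁]
    exact fun f hf => Or.inl (Or.inl hf)
  · rw [hBE, ← hE₂]
    exact fun f hf => Or.inl (Or.inr hf)
  · rw [hBE, hE₁, hE₂, hPE]
    have e1 : (Set.range e').ncard ≤ n := by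
      rw [← Set.image_univ]
      refine (Set.ncard_image_le Set.finite_univ).trans ?_
      rw [Set.ncard_univ, Nat.card_eq_fintype_card, Fintype.card_fin]
    have e2 := Set.ncard_union_le (D.edgesAt C₁ ∪ D.edgesAt C₂ : Set β) (Set.range e')
    have e3 := Set.ncard_union_le (D.edgesAt C₁ : Set β) (D.edgesAt C₂)
    rw [Set.ncard_coe_finset, Set.ncard_coe_finset] at e3
    have e4 := card_edgesAt_le hP₁
    have e5 := card_edgesAt_le hP₂
    omega

/-- Two unbalanced components joined by a path are contained in a barbell. -/
theorem exists_barbell (hF : F.IsTwoFactor G) (hcyc : (D.cyc : Set β) = E(F))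
    (hC₁ : C₁ ∈ D.unbalanced F σ) (hC₂ : C₂ ∈ D.unbalanced F σ) (hne : C₁ ≠ C₂) {n : ℕ}
    {x : ℕ → α} {e : ℕ → β} (hp : G.IsPathSeq E(G) u v n x e) (hu : u ∈ C₁) (hv : v ∈ C₂) :
    ∃ B ≤ G, IsBarbell σ B ∧ (D.edgesAt C₁ : Set β) ⊆ E(B) ∧ (D.edgesAt C₂ : Set β) ⊆ E(B) ∧
      E(B).ncard ≤ n + (C₁.card + C₂.card) := by
  have hP₁ := (Finset.mem_filter.1 hC₁).1
  have hP₂ := (Finset.mem_filter.1 hC₂).1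
  have hdisj : ∀ z, z ∈ C₁ → z ∉ C₂ := fun z hz hz' =>
    hne (by rw [← ((mem_of_mem_parts hP₁).1 hz).2, ← ((mem_of_mem_parts hP₂).1 hz').2])
  have hex : ∃ i, x i ∈ C₂ := ⟨n, hp.last ▸ hv⟩
  -- The path is trimmed to run from its last visit to `C₁` before the first visit to `C₂` up to
  -- that first visit; it then meets the two circuits only in its ends.
  let j := Nat.find hex
  have hj : x j ∈ C₂ := Nat.find_spec hex
  have hjmin : ∀ m < j, x m ∉ C₂ := fun m hm => Nat.find_min hex hm
  have hjn : j ≤ n := Nat.find_min' hex (hp.last ▸ hv)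
  let i := Nat.findGreatest (fun m => x m ∈ C₁) j
  have hx0 : x 0 ∈ C₁ := hp.head ▸ hu
  have hi : x i ∈ C₁ :=
    Nat.findGreatest_spec (P := fun m => x m ∈ C₁) (Nat.zero_le j) hx0
  have hij : i ≤ j := Nat.findGreatest_le j
  have himax : ∀ m, i < m → m ≤ j → x m ∉ C₁ := fun m h1 h2 =>
    Nat.findGreatest_is_greatest h1 h2
  have hp' : G.IsPathSeq E(G) (x i) (x j) (j - i) (fun k => x (i + k)) (fun k => e (i + k)) := by
    refine ⟨rfl, by simp only [Nat.add_sub_cancel' hij], ?_, fun k hk => hp.mem _ (by omega),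
      fun k hk => hp.link _ (by omega)⟩
    intro a ha b hb hab
    rw [Set.mem_Iic] at ha hb
    have := hp.inj (Set.mem_Iic.2 (by omega)) (Set.mem_Iic.2 (by omega)) hab
    omega
  obtain ⟨B, hBG, hB, hB₁, hB₂, hBc⟩ := exists_barbell_of_path hF hcyc hC₁ hC₂ hne hp'
    (fun k hk => ⟨fun h => by
        by_contra hk0
        exact himax (i + k) (by omega) (by omega) h,
      fun h => by subst h; exact hi⟩)
    (fun k hk => ⟨fun h => by
        by_contra hk0
        exact hjmin (i + k) (by omega) h,
      fun h => by subst h; simpa only [Nat.add_sub_cancel' hij] using hj⟩)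
  exact ⟨B, hBG, hB, hB₁, hB₂, hBc.trans (by omega)⟩

/-- Barbells covering the components in `W`, which a set of edges joins up in pairs. -/
theorem exists_barbells [Nonempty β] (hF : F.IsTwoFactor G) (hcyc : (D.cyc : Set β) = E(F))
    {w : Finset α → α} (hw : ∀ C ∈ D.parts, w C ∈ C) (W : Finset (Finset α))
    (hW : W ⊆ D.unbalanced F σ) (hK : (K : Set β) ⊆ E(G))
    (hKb : ∀ z ∈ D.verts, G.boundary K z =
      if D.part z ∈ W ∧ z = w (D.part z) then 1 else 0) :
    ∃ 𝓕 : Multiset (Graph α β), (∀ S ∈ 𝓕, S ≤ G ∧ IsBarbell σ S) ∧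
      (∀ C ∈ W, ∀ e ∈ D.edgesAt C, ∃ S ∈ 𝓕, e ∈ E(S)) ∧
      familyLength 𝓕 ≤ K.card + ∑ C ∈ W, C.card := by
  induction hn : W.card using Nat.strong_induction_on generalizing W K with
  | _ m ih =>
  rcases W.eq_empty_or_nonempty with rfl | ⟨C₁, hC₁⟩
  · exact ⟨0, by simp, by simp, by simp [familyLength]⟩
  have hpart : ∀ C ∈ W, C ∈ D.parts := fun C hC => (Finset.mem_filter.1 (hW hC)).1
  have hwC : ∀ C ∈ W, w C ∈ D.verts ∧ D.part (w C) = C :=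
    fun C hC => (mem_of_mem_parts (hpart C hC)).1 (hw C (hpart C hC))
  obtain ⟨hu, hpu⟩ := hwC C₁ hC₁
  set u := w C₁ with hudef
  have hub : G.boundary K u = 1 := by
    rw [hKb u hu, hpu, if_pos ⟨hC₁, rfl⟩]
  -- The boundary of `K` sums to zero over the component of `u` in `K`, so `u` cannot be its only
  -- odd vertex there.
  obtain ⟨v, hvX, hvu, hvb⟩ : ∃ v ∈ {y ∈ D.verts | Relation.ReflTransGen (G.AdjIn K) u y},
      v ≠ u ∧ G.boundary K v ≠ 0 := by
    by_contra! hcon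
    have h0 := sum_boundary_eq_zero (G := G) (K := K)
      (X := {y ∈ D.verts | Relation.ReflTransGen (G.AdjIn K) u y}) (by
        intro e he x y hl
        have h1 := mem_verts_of_inc (D := D) hl.inc_left
        have h2 := mem_verts_of_inc (D := D) hl.inc_right
        simp only [Finset.mem_filter, h1, h2, true_and]
        exact ⟨fun h => h.tail ⟨e, he, hl⟩, fun h => h.tail ⟨e, he, hl.symm⟩⟩)
    rw [Finset.sum_eq_single_of_mem u (Finset.mem_filter.2 ⟨hu, .refl⟩) hcon, hub] at h0
    exact absurd h0 (by decide)
  obtain ⟨hv, huv⟩ := Finset.mem_filter.1 hvX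
  have hvW : D.part v ∈ W ∧ v = w (D.part v) := by
    by_contra h
    exact hvb (by rw [hKb v hv, if_neg h])
  obtain ⟨hC₂, hvw⟩ := hvW
  have hvb1 : G.boundary K v = 1 := by rw [hKb v hv, if_pos ⟨hC₂, hvw⟩]
  set C₂ := D.part v with hC₂def
  have hne : C₁ ≠ C₂ := fun h => hvu (by rw [hvw, ← h])
  obtain ⟨n, x, e, hp⟩ := exists_isPathSeq huv
  have hpG : G.IsPathSeq E(G) u v n x e :=
    ⟨hp.head, hp.last, hp.inj, fun i hi => hK (hp.mem i hi), hp.link⟩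
  obtain ⟨B, hBG, hB, hB₁, hB₂, hBc⟩ := exists_barbell hF hcyc (hW hC₁) (hW hC₂) hne hpG
    (hw C₁ (hpart C₁ hC₁)) (self_mem_part hv)
  have hLK : pathEdges n e ⊆ K := fun f hf => hp.pathEdges_subset hf
  have hC₂e : C₂ ∈ W.erase C₁ := Finset.mem_erase.2 ⟨hne.symm, hC₂⟩
  have hcard : ((W.erase C₁).erase C₂).card < m := by
    rw [← hn, Finset.card_erase_of_mem hC₂e, Finset.card_erase_of_mem hC₁]
    have := Finset.card_pos.2 ⟨C₁, hC₁⟩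
    omega
  -- Removing the path from `K` cancels the boundary at `u` and `v` and nowhere else. The whole path
  -- is removed, although the barbell may use only part of it.
  obtain ⟨𝓕, h1, h2, h3⟩ := ih _ hcard (K := K \ pathEdges n e) ((W.erase C₁).erase C₂)
    (fun C hC => hW (Finset.mem_of_mem_erase (Finset.mem_of_mem_erase hC)))
    (fun f hf => hK (Finset.mem_sdiff.1 hf).1)
    (by
      intro z hz
      rw [boundary_sdiff hLK, hp.boundary_pathEdges]
      by_cases hzu : z = u
      · subst hzu
        rw [hub, if_pos rfl, if_neg hvu.symm, if_neg]
        · decide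
        · simp [hpu]
      by_cases hzv : z = v
      · subst hzv
        rw [hvb1, if_pos rfl, if_neg hvu, if_neg]
        · decide
        · simp [← hC₂def]
      rw [if_neg hzu, if_neg hzv, add_zero, add_zero, hKb z hz]
      refine if_congr ⟨fun h => ⟨?_, h.2⟩, fun h => ⟨?_, h.2⟩⟩ rfl rfl
      · refine Finset.mem_erase.2 ⟨fun h' => hzv ?_, Finset.mem_erase.2 ⟨fun h' => hzu ?_, h.1⟩⟩
        · rw [h.2, h', ← hvw]
        · rw [h.2, h']
      · exact Finset.mem_of_mem_erase (Finset.mem_of_mem_erase h.1)) rfl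
  refine ⟨B ::ₘ 𝓕, fun S hS => ?_, fun C hC f hf => ?_, ?_⟩
  · rcases Multiset.mem_cons.1 hS with rfl | hS
    · exact ⟨hBG, hB⟩
    · exact h1 S hS
  · by_cases hCC₁ : C = C₁
    · exact ⟨B, Multiset.mem_cons_self _ _, hB₁ (hCC₁ ▸ hf)⟩
    by_cases hCC₂ : C = C₂
    · exact ⟨B, Multiset.mem_cons_self _ _, hB₂ (hCC₂ ▸ hf)⟩
    obtain ⟨S, hS, hfS⟩ := h2 C
      (Finset.mem_erase.2 ⟨hCC₂, Finset.mem_erase.2 ⟨hCC₁, hC⟩⟩) f hf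
    exact ⟨S, Multiset.mem_cons_of_mem hS, hfS⟩
  · have hsum := Finset.add_sum_erase _ (fun C : Finset α => C.card) hC₂e
    have hsum' := Finset.add_sum_erase _ (fun C : Finset α => C.card) hC₁
    have hc := Finset.card_sdiff_add_card_eq_card hLK
    rw [hp.card_pathEdges] at hc
    simp only [familyLength, Multiset.map_cons, Multiset.sum_cons] at h3 ⊢
    omega

end CircuitPartition

/-- The cover of a two-factor by its balanced circuits and by barbells. -/
theorem exists_signCircuitFamily (hV : V(G).Finite) (hE : E(G).Finite)
    (hcubic : G.IsCubic) (hconn : G.IsTwoEdgeConnected)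
    (hF : F.IsTwoFactor G) (heven : Even (negativeEdges σ F).ncard) :
    ∃ 𝓕 : Multiset (Graph α β), IsSignCircuitFamily σ G 𝓕 ∧ Covers 𝓕 F ∧
      3 * familyLength 𝓕 ≤ 5 * hV.toFinset.card := by
  obtain ⟨D, hcyc⟩ := exists_circuitPartition hV hE hcubic hconn hF
  obtain ⟨x₀, hx₀⟩ := hconn.1.1
  have : Nonempty α := ⟨x₀⟩
  obtain ⟨e₀, -⟩ := D.exists_mat x₀ ((D.mem_verts x₀).2 hx₀)
  have : Nonempty β := ⟨e₀⟩
  have hverts : D.verts = hV.toFinset := by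
    ext z
    rw [D.mem_verts, hV.mem_toFinset]
  have hUP : D.unbalanced F σ ⊆ D.parts := Finset.filter_subset _ _
  obtain ⟨K, hK, w, hw, hKb, hKc⟩ := D.exists_edges hUP
    (CircuitPartition.even_card_unbalanced hF.1.le hcyc heven)
  obtain ⟨𝓕, h1, h2, h3⟩ := CircuitPartition.exists_barbells hF hcyc hw _ subset_rfl hK hKb
  have hmem : ∀ S, S ∈ 𝓕 + (D.parts \ D.unbalanced F σ).val.map (fun C : Finset α => F.induce (C : Set α)) ↔
      S ∈ 𝓕 ∨ ∃ C ∈ D.parts \ D.unbalanced F σ, F.induce (C : Set α) = S := by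
    intro S
    simp only [Multiset.mem_add, Multiset.mem_map, Finset.mem_val]
  refine ⟨𝓕 + (D.parts \ D.unbalanced F σ).val.map (fun C : Finset α => F.induce (C : Set α)),
    fun S hS => ?_, fun e he => ?_, ?_⟩
  · rcases (hmem S).1 hS with hS | ⟨C, hC, rfl⟩
    · exact ⟨(h1 S hS).1, Or.inr (h1 S hS).2⟩
    · obtain ⟨hCP, hCU⟩ := Finset.mem_sdiff.1 hC
      refine ⟨CircuitPartition.induce_part_le hF hCP, Or.inl
        ⟨CircuitPartition.isCircuit_induce_part hF hcyc hCP, ?_⟩⟩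
      rw [← Nat.not_odd_iff_even]
      exact fun h => hCU (Finset.mem_filter.2 ⟨hCP, h⟩)
  · have hec : e ∈ D.cyc := by
      rw [← Finset.mem_coe, hcyc]
      exact he
    obtain ⟨x, y, hl⟩ := exists_isLink_of_mem_edgeSet (CircuitPartition.cyc_subset (D := D) hec)
    have hx := CircuitPartition.mem_verts_of_inc (D := D) hl.inc_left
    have heat : e ∈ D.edgesAt (D.part x) :=
      Finset.mem_filter.2 ⟨hec, x, CircuitPartition.self_mem_part hx, hl.inc_left⟩
    have hP := CircuitPartition.part_mem_parts hx
    by_cases hU : D.part x ∈ D.unbalanced F σ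
    · obtain ⟨S, hS, heS⟩ := h2 _ hU e heat
      exact ⟨S, (hmem S).2 (Or.inl hS), heS⟩
    · refine ⟨_, (hmem _).2 (Or.inr ⟨_, Finset.mem_sdiff.2 ⟨hP, hU⟩, rfl⟩), ?_⟩
      rw [CircuitPartition.edgeSet_induce_part hF.1.le hcyc hP]
      exact heat
  -- The circuits contribute at most |V| edges in total and the connecting paths at most |K| ≤ 2/3
  -- |V|.
  · have hbal : ∑ C ∈ D.parts \ D.unbalanced F σ, E(F.induce (C : Set α)).ncard ≤
        ∑ C ∈ D.parts \ D.unbalanced F σ, C.card := by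
      refine Finset.sum_le_sum fun C hC => ?_
      have hCP := (Finset.mem_sdiff.1 hC).1
      rw [CircuitPartition.edgeSet_induce_part hF.1.le hcyc hCP, Set.ncard_coe_finset]
      exact CircuitPartition.card_edgesAt_le hCP
    have hsplit := Finset.sum_sdiff (f := fun C : Finset α => C.card) hUP
    rw [CircuitPartition.sum_card_parts] at hsplit
    have hlen : familyLength (𝓕 +
        (D.parts \ D.unbalanced F σ).val.map (fun C : Finset α => F.induce (C : Set α))) =
        familyLength 𝓕 + ∑ C ∈ D.parts \ D.unbalanced F σ, E(F.induce (C : Set α)).ncard := by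
      simp only [familyLength, Multiset.map_add, Multiset.sum_add, Multiset.map_map]
      rfl
    rw [hlen, ← hverts]
    omega

end

end Graph

open scoped Graph in
theorem mainTheorem3 {α β : Type*} (G F : Graph α β) (σ : β → ℤˣ)
    (hV : V(G).Finite) (hE : E(G).Finite)
    (hcubic : G.IsCubic) (hconn : G.IsTwoEdgeConnected)
    (hF : F.IsTwoFactor G) (heven : Even (Graph.negativeEdges σ F).ncard) :
    ∃ 𝓕 : Multiset (Graph α β),
      Graph.IsSignCircuitFamily σ G 𝓕 ∧ Graph.Covers 𝓕 F ∧
        (Graph.familyLength 𝓕 : ℚ) ≤ 10 / 9 * (E(G).ncard : ℚ) := by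
  obtain ⟨𝓕, h1, h2, h3⟩ := Graph.exists_signCircuitFamily hV hE hcubic hconn hF heven
  refine ⟨𝓕, h1, h2, ?_⟩
  have h4 := Graph.three_mul_card_le hV hE hcubic
  -- From 3ℓ ≤ 5|V| and 3|V| ≤ 2|E| one gets 9ℓ ≤ 15|V| ≤ 10|E|.
  have h5 : 9 * Graph.familyLength 𝓕 ≤ 10 * E(G).ncard := by omega
  have h6 : (9 * Graph.familyLength 𝓕 : ℚ) ≤ 10 * E(G).ncard := by exact_mod_cast h5
  linarith
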